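/- Let $X$ be a finite set. A pair $(\mathcal A,\mathcal B)$ of families of subsets of $X$ is called a \emph{recovering pair} over $X$ if for all $A,A'\in\mathcal A$ and $B,B'\in\mathcal B$, $$A\setminus B=A'\setminus B'\implies A=A',\qquad B\setminus A=B'\setminus A'\implies B=B',$$ and a \emph{cancellative pair} over $X$ if for all $A,A'\in\mathcal A$ and $B,B'\in\mathcal B$, $$A\setminus B=A'\setminus B\implies A=A',\qquad B\setminus A=B'\setminus A\implies B=B'.$$ Put $$\mu_{\mathrm{rec}}=\lim_{n\to\infty}\max\{(|\mathcal A||\mathcal B|)^{1/n}:(\mathcal A,\mathcal B)\text{ is a recovering pair over }[n]\},$$ $$\mu_{\mathrm{can}}=\lim_{n\to\infty}\max\{(|\mathcal A||\mathcal B|)^{1/n}:(\mathcal A,\mathcal B)\text{ is a cancellative pair over }[n]\}.$$ Then both limits exist, and with $\alpha=0.27$ and $\theta=2.222$, every recovering pair $(\mathcal A,\mathcal B)$ over a set of $n$ elements satisfies $$|\mathcal A||\mathcal B|\le\max\{2.2499,\ \theta^{\alpha}\,\mu_{\mathrm{can}}^{1-\alpha}\}^n.$$ In particular, $\mu_{\mathrm{rec}}<\mu_{\mathrm{can}}$.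 -/

import Mathlib

/-- `(A, B)` is a recovering pair over `X`. -/
def IsRecoveringPair {X : Type*} [DecidableEq X] (A B : Finset (Finset X)) : Prop :=
  ∀ S ∈ A, ∀ S' ∈ A, ∀ T ∈ B, ∀ T' ∈ B,
    (S \ T = S' \ T' → S = S') ∧ (T \ S = T' \ S' → T = T')

/-- `(A, B)` is a cancellative pair over `X`. -/
def IsCancellativePair {X : Type*} [DecidableEq X] (A B : Finset (Finset X)) : Prop :=
  ∀ S ∈ A, ∀ S' ∈ A, ∀ T ∈ B, ∀ T' ∈ B,
    (S \ T = S' \ T → S = S') ∧ (T \ S = T' \ S → T = T')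

/-- The values `(|A||B|)^(1/n)` over all recovering pairs `(A, B)` over an `n`-element set. -/
def recValues (n : ℕ) : Set ℝ :=
  {r | ∃ A B : Finset (Finset (Fin n)), IsRecoveringPair A B ∧
    r = ((A.card : ℝ) * (B.card : ℝ)) ^ (1 / (n : ℝ))}

/-- The values `(|A||B|)^(1/n)` over all cancellative pairs `(A, B)` over an `n`-element set. -/
def canValues (n : ℕ) : Set ℝ :=
  {r | ∃ A B : Finset (Finset (Fin n)), IsCancellativePair A B ∧
    r = ((A.card : ℝ) * (B.card : ℝ)) ^ (1 / (n : ℝ))}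

/-- The maximum of `(|A||B|)^(1/n)` over recovering pairs; see `isGreatest_maxRec`. -/
noncomputable def maxRec (n : ℕ) : ℝ := sSup (recValues n)

/-- The maximum of `(|A||B|)^(1/n)` over cancellative pairs; see `isGreatest_maxCan`. -/
noncomputable def maxCan (n : ℕ) : ℝ := sSup (canValues n)

/-- The optimal rate for recovering pairs. -/
noncomputable def muRec : ℝ := Filter.limUnder Filter.atTop maxRec

/-- The optimal rate for cancellative pairs. -/
noncomputable def muCan : ℝ := Filter.limUnder Filter.atTop maxCan

theorem isGreatest_maxRec (n : ℕ) : IsGreatest (recValues n) (maxRec n) := by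
  have hfin : (recValues n).Finite :=
    (Set.finite_range fun p : Finset (Finset (Fin n)) × Finset (Finset (Fin n)) =>
      ((p.1.card : ℝ) * (p.2.card : ℝ)) ^ (1 / (n : ℝ))).subset
      (by rintro r ⟨A, B, -, rfl⟩; exact ⟨(A, B), rfl⟩)
  have hne : (recValues n).Nonempty := ⟨_, ∅, ∅, by simp [IsRecoveringPair], rfl⟩
  exact ⟨hne.csSup_mem hfin, fun r hr => le_csSup hfin.bddAbove hr⟩

theorem isGreatest_maxCan (n : ℕ) : IsGreatest (canValues n) (maxCan n) := by
  have hfin : (canValues n).Finite :=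
    (Set.finite_range fun p : Finset (Finset (Fin n)) × Finset (Finset (Fin n)) =>
      ((p.1.card : ℝ) * (p.2.card : ℝ)) ^ (1 / (n : ℝ))).subset
      (by rintro r ⟨A, B, -, rfl⟩; exact ⟨(A, B), rfl⟩)
  have hne : (canValues n).Nonempty := ⟨_, ∅, ∅, by simp [IsCancellativePair], rfl⟩
  exact ⟨hne.csSup_mem hfin, fun r hr => le_csSup hfin.bddAbove hr⟩

/-! The first entry of the maximum already suffices: every recovering pair satisfies `|A||B| ≤
2.2499 ^ n`, while a random linear code gives `muCan ≥ 2.25` in the limit, hence `2.2499 < muCan`.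
The two limits exist by Fekete's lemma, since both classes are closed under block products.

For the upper bound let `S ∈ A`, `T ∈ B` be uniform and independent, with coordinate densities `p
i`, `q i`. For any `Y`, the pair `(S \ T, T ∩ Y)` determines `S`, and then `T ∩ (S ∪ Y)`, so its
entropy is `log |A|` plus the mean entropy of the trace of `T` on `S ∪ Y`. Gibbs' inequality bounds
the same entropy coordinate by coordinate (`log_card_add_traceEntropy_le`).

Trace entropy is submodular, so the greedy algorithm supplies an additive minorant `b` of total `log
|B|` that is exact on a chosen chain of sets `Y`. Averaging over the chain leaves an inequality
linear in `b`; adding `κ log |B| = κ ∑ b i` and choosing the chain well eliminates `b`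
(`log_card_add_mul_log_card_le`). The sum of this bound and its mirror image is `(1 + κ) log
(|A||B|) ≤ ∑ i, (coordBound κ (p i) (q i) + coordBound κ (q i) (p i))`. With `κ = 3 / 10`, a
two-variable numerical bound, certified by rational branch and bound, finishes.

For the lower bound, the `k`-sets whose columns in a random matrix over `𝔽₂` are independent and
have a prescribed sum form a family cancellative with itself; optimising `k` gives size `(3/2) ^ n`
up to a polynomial factor. -/

/-! ### Entropy on a uniform finite space. -/

/-- Shannon entropy (in nats) of `f` under the uniform distribution on `Ω`. -/
noncomputable def unifEntropy {α β : Type*} [DecidableEq β] (Ω : Finset α) (f : α → β) : ℝ :=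
  (∑ x ∈ Ω, Real.log (Ω.card / (Ω.filter fun y => f y = f x).card)) / Ω.card

theorem card_fiber_pos {α β : Type*} [DecidableEq β] {Ω : Finset α} (f : α → β) {x : α}
    (hx : x ∈ Ω) : (0 : ℝ) < (Ω.filter fun y => f y = f x).card := by
  exact_mod_cast Finset.card_pos.2 ⟨x, by simp [hx]⟩

/-- Gibbs' inequality, with the reference weights indexed by the sample space. -/
theorem unifEntropy_le_of_sum_le {α β : Type*} [DecidableEq β] {Ω : Finset α} (hΩ : Ω.Nonempty)
    (f : α → β) (r : α → ℝ) (hr : ∀ x ∈ Ω, 0 < r x)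
    (hsum : ∑ x ∈ Ω, r x / (Ω.filter fun y => f y = f x).card ≤ 1) :
    unifEntropy Ω f ≤ (∑ x ∈ Ω, -Real.log (r x)) / Ω.card := by
  have hc : (0 : ℝ) < Ω.card := by exact_mod_cast hΩ.card_pos
  unfold unifEntropy
  refine div_le_div_of_nonneg_right ?_ hc.le
  -- `log t ≤ t - 1`, where `t` is the ratio of the reference weight to the true probability of the
  -- value `f x`.
  have h1 : ∀ x ∈ Ω, Real.log (Ω.card / (Ω.filter fun y => f y = f x).card) ≤
      -Real.log (r x) + (Ω.card * (r x / (Ω.filter fun y => f y = f x).card) - 1) := by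
    intro x hx
    have hf := card_fiber_pos f hx
    have h2 := Real.log_le_sub_one_of_pos (mul_pos (div_pos hc hf) (hr x hx))
    rw [Real.log_mul (div_pos hc hf).ne' (hr x hx).ne'] at h2
    rw [show (Ω.card : ℝ) * (r x / (Ω.filter fun y => f y = f x).card) =
      Ω.card / (Ω.filter fun y => f y = f x).card * r x by ring]
    linarith
  refine (Finset.sum_le_sum h1).trans ?_
  rw [Finset.sum_add_distrib, Finset.sum_sub_distrib, ← Finset.mul_sum]
  simp only [Finset.sum_const, nsmul_eq_mul, mul_one]
  nlinarith

/-- A sum over the sample space of a function of `f`, weighted by inverse fibre sizes, is a sum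
over the values of `f`. -/
theorem sum_div_card_fiber {α β : Type*} [DecidableEq β] (Ω : Finset α) (f : α → β) (r : β → ℝ) :
    ∑ x ∈ Ω, r (f x) / (Ω.filter fun y => f y = f x).card = ∑ z ∈ Ω.image f, r z := by
  rw [← Finset.sum_fiberwise_of_maps_to (g := f) (t := Ω.image f)
    (fun x hx => Finset.mem_image_of_mem f hx)]
  refine Finset.sum_congr rfl fun z hz => ?_
  obtain ⟨x, hx, rfl⟩ := Finset.mem_image.1 hz
  have hf := card_fiber_pos f hx
  rw [Finset.sum_congr rfl (g := fun _ => r (f x) / (Ω.filter fun y => f y = f x).card)]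
  · simp only [Finset.sum_const, nsmul_eq_mul]
    field_simp
  · intro y hy
    rw [(Finset.mem_filter.1 hy).2]

theorem unifEntropy_le {α β : Type*} [DecidableEq β] {Ω : Finset α} (hΩ : Ω.Nonempty)
    (f : α → β) (r : β → ℝ) (hr : ∀ x ∈ Ω, 0 < r (f x)) (hsum : ∑ z ∈ Ω.image f, r z ≤ 1) :
    unifEntropy Ω f ≤ (∑ x ∈ Ω, -Real.log (r (f x))) / Ω.card :=
  unifEntropy_le_of_sum_le hΩ f (fun x => r (f x)) hr (by rwa [sum_div_card_fiber])

/-- Submodularity of entropy: `H(f, g, k) + H(k) ≤ H(f, k) + H(g, k)`. -/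
theorem unifEntropy_submodular {α β γ δ ε : Type*} [DecidableEq β] [DecidableEq γ] [DecidableEq δ]
    [DecidableEq ε] {Ω : Finset α} (u : α → β) (f : α → γ) (g : α → δ)
    (k : α → ε) (hu : ∀ x y, u x = u y ↔ f x = f y ∧ g x = g y)
    (hf : ∀ x y, f x = f y → k x = k y) (hg : ∀ x y, g x = g y → k x = k y) :
    unifEntropy Ω u + unifEntropy Ω k ≤ unifEntropy Ω f + unifEntropy Ω g := by
  rcases Ω.eq_empty_or_nonempty with rfl | hΩ
  · simp [unifEntropy]
  have hc : (0 : ℝ) < Ω.card := by exact_mod_cast hΩ.card_pos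
  set nf : α → ℝ := fun x => (Ω.filter fun y => f y = f x).card with hnf
  set ng : α → ℝ := fun x => (Ω.filter fun y => g y = g x).card with hng
  set nk : α → ℝ := fun x => (Ω.filter fun y => k y = k x).card with hnk
  set nu : α → ℝ := fun x => (Ω.filter fun y => u y = u x).card with hnu
  have pf : ∀ x ∈ Ω, 0 < nf x := fun x hx => card_fiber_pos f hx
  have pg : ∀ x ∈ Ω, 0 < ng x := fun x hx => card_fiber_pos g hx
  have pk : ∀ x ∈ Ω, 0 < nk x := fun x hx => card_fiber_pos k hx
  have pu : ∀ x ∈ Ω, 0 < nu x := fun x hx => card_fiber_pos u hx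
  -- This is the total mass of the law that makes `f` and `g` conditionally independent given `k`.
  -- Writing `nf x * ng x` as a count of pairs `(y, z)` allows summation over `x` first.
  have key : ∑ x ∈ Ω, nf x * ng x / (nk x * nu x) ≤ Ω.card := by
    have e1 : ∀ x ∈ Ω, nf x * ng x / (nk x * nu x) =
        ∑ y ∈ Ω, ∑ z ∈ Ω, if f y = f x ∧ g z = g x then 1 / (nk x * nu x) else 0 := by
      intro x _
      have : nf x * ng x = ∑ y ∈ Ω, ∑ z ∈ Ω, if f y = f x ∧ g z = g x then (1 : ℝ) else 0 := by
        simp only [hnf, hng, Finset.card_filter, Nat.cast_sum, Finset.sum_mul_sum]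
        refine Finset.sum_congr rfl fun y _ => Finset.sum_congr rfl fun z _ => ?_
        by_cases h1 : f y = f x <;> by_cases h2 : g z = g x <;> simp [h1, h2]
      rw [this, Finset.sum_div]
      refine Finset.sum_congr rfl fun y _ => ?_
      rw [Finset.sum_div]
      refine Finset.sum_congr rfl fun z _ => ?_
      split_ifs <;> simp
    rw [Finset.sum_congr rfl e1, Finset.sum_comm]
    have e2 : ∀ y ∈ Ω, ∑ x ∈ Ω, ∑ z ∈ Ω,
        (if f y = f x ∧ g z = g x then 1 / (nk x * nu x) else 0) ≤ 1 := by
      intro y hy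
      rw [Finset.sum_comm]
      -- For fixed `y`, `z` the contributing `x` form one fibre of `u` or none, which cancels `nu`.
      have e3 : ∀ z ∈ Ω, ∑ x ∈ Ω, (if f y = f x ∧ g z = g x then 1 / (nk x * nu x) else 0) ≤
          if k z = k y then 1 / nk y else 0 := by
        intro z hz
        by_cases hex : ∃ x ∈ Ω, f y = f x ∧ g z = g x
        · obtain ⟨x₀, hx₀, h1, h2⟩ := hex
          have hk1 : k y = k x₀ := hf _ _ h1
          have hk2 : k z = k x₀ := hg _ _ h2
          rw [if_pos (hk2.trans hk1.symm), ← Finset.sum_filter]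
          have : (Ω.filter fun x => f y = f x ∧ g z = g x) = Ω.filter fun x => u x = u x₀ := by
            ext x
            simp only [Finset.mem_filter, hu, h1, h2]
            constructor <;> rintro ⟨a, b, c⟩ <;> exact ⟨a, b.symm, c.symm⟩
          rw [this, Finset.sum_congr rfl (g := fun _ => 1 / (nk y * nu x₀))]
          · rw [Finset.sum_const, nsmul_eq_mul]
            have h3 := pu x₀ hx₀
            have h4 := pk y hy
            rw [show ((Ω.filter fun x => u x = u x₀).card : ℝ) = nu x₀ from rfl]
            apply le_of_eq
            field_simp
          · intro x hx
            have hx' := (Finset.mem_filter.1 hx).2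
            have a1 : nk x = nk y := by
              simp only [hnk, hf x x₀ ((hu _ _).1 hx').1, hk1]
            have a2 : nu x = nu x₀ := by simp only [hnu, hx']
            rw [a1, a2]
        · rw [Finset.sum_eq_zero]
          · split_ifs
            · exact (one_div_pos.2 (pk y hy)).le
            · exact le_rfl
          · intro x hx
            rw [if_neg fun h => hex ⟨x, hx, h⟩]
      refine (Finset.sum_le_sum e3).trans ?_
      rw [← Finset.sum_filter, Finset.sum_const, nsmul_eq_mul]
      exact (mul_one_div_cancel (pk y hy).ne').le
    exact (Finset.sum_le_sum e2).trans (by simp)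
  have hG := unifEntropy_le_of_sum_le hΩ u (fun x => nf x * ng x / (nk x * Ω.card))
    (fun x hx => div_pos (mul_pos (pf x hx) (pg x hx)) (mul_pos (pk x hx) hc)) (by
      have : ∀ x ∈ Ω, nf x * ng x / (nk x * Ω.card) / nu x =
          nf x * ng x / (nk x * nu x) / Ω.card := by
        intro x hx
        have h1 := pk x hx
        have h2 := pu x hx
        field_simp
      rw [Finset.sum_congr rfl this, ← Finset.sum_div]
      exact (div_le_one hc).2 key)
  have e : unifEntropy Ω f + unifEntropy Ω g - unifEntropy Ω k =
      (∑ x ∈ Ω, -Real.log (nf x * ng x / (nk x * Ω.card))) / Ω.card := by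
    unfold unifEntropy
    rw [← add_div, ← sub_div, ← Finset.sum_add_distrib, ← Finset.sum_sub_distrib]
    congr 1
    refine Finset.sum_congr rfl fun x hx => ?_
    have h1 := pf x hx
    have h2 := pg x hx
    have h3 := pk x hx
    rw [Real.log_div (mul_pos h1 h2).ne' (mul_pos h3 hc).ne', Real.log_mul h1.ne' h2.ne',
      Real.log_mul h3.ne' hc.ne', Real.log_div hc.ne' h1.ne', Real.log_div hc.ne' h2.ne',
      Real.log_div hc.ne' h3.ne']
    ring
  linarith

/-! ### Entropy of traces and the basic inequality for recovering pairs. -/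

section TraceEntropy

variable {X : Type*} [DecidableEq X]

/-- Entropy of the trace on `S` of a uniformly random member of `F`. -/
noncomputable def traceEntropy (F : Finset (Finset X)) (S : Finset X) : ℝ :=
  unifEntropy F fun T => T ∩ S

/-- Proportion of the members of `F` that contain `i`. -/
noncomputable def density (F : Finset (Finset X)) (i : X) : ℝ :=
  (F.filter fun T => i ∈ T).card / F.card

theorem density_nonneg (F : Finset (Finset X)) (i : X) : 0 ≤ density F i := by
  unfold density; positivity

theorem density_le_one (F : Finset (Finset X)) (i : X) : density F i ≤ 1 := by
  unfold density
  exact div_le_one_of_le₀ (by exact_mod_cast Finset.card_filter_le _ _) (by positivity)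

theorem density_pos {F : Finset (Finset X)} {i : X} {T : Finset X} (hT : T ∈ F) (hi : i ∈ T) :
    0 < density F i := by
  have h1 : 0 < (F.filter fun T => i ∈ T).card := Finset.card_pos.2 ⟨T, by simp [hT, hi]⟩
  have h2 : 0 < F.card := Finset.card_pos.2 ⟨T, hT⟩
  unfold density
  positivity

theorem density_lt_one {F : Finset (Finset X)} {i : X} {T : Finset X} (hT : T ∈ F) (hi : i ∉ T) :
    density F i < 1 := by
  have h2 : 0 < F.card := Finset.card_pos.2 ⟨T, hT⟩
  unfold density
  rw [div_lt_one (by exact_mod_cast h2)]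
  exact_mod_cast Finset.card_lt_card (Finset.filter_ssubset.2 ⟨T, hT, hi⟩)

theorem sum_ite_mem_eq_density {F : Finset (Finset X)} (hF : F.Nonempty) (i : X) (x y : ℝ) :
    ∑ T ∈ F, (if i ∈ T then x else y) =
      F.card * (density F i * x + (1 - density F i) * y) := by
  have h2 : (0 : ℝ) < F.card := by exact_mod_cast hF.card_pos
  have h3 := Finset.card_filter_add_card_filter_not (s := F) (fun T => i ∈ T)
  have h4 : ((F.filter fun T => i ∉ T).card : ℝ) = F.card - (F.filter fun T => i ∈ T).card := by
    rw [← h3]; push_cast; ring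
  rw [Finset.sum_ite, Finset.sum_const, Finset.sum_const, nsmul_eq_mul, nsmul_eq_mul, h4]
  unfold density
  field_simp

theorem traceEntropy_submodular (F : Finset (Finset X)) (S T : Finset X) :
    traceEntropy F (S ∪ T) + traceEntropy F (S ∩ T) ≤ traceEntropy F S + traceEntropy F T := by
  apply unifEntropy_submodular
  · intro x y
    simp only [Finset.ext_iff, Finset.mem_inter, Finset.mem_union]
    constructor
    · intro h
      exact ⟨fun i => by have := h i; tauto, fun i => by have := h i; tauto⟩
    · rintro ⟨h1, h2⟩ i
      have := h1 i
      have := h2 i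
      tauto
  · intro x y h
    rw [← Finset.inter_assoc, ← Finset.inter_assoc, h]
  · intro x y h
    rw [Finset.inter_comm S T, ← Finset.inter_assoc, ← Finset.inter_assoc, h]

theorem traceEntropy_empty (F : Finset (Finset X)) : traceEntropy F ∅ = 0 := by
  rcases F.eq_empty_or_nonempty with rfl | hF
  · simp [traceEntropy, unifEntropy]
  have h2 : (F.card : ℝ) ≠ 0 := by exact_mod_cast hF.card_pos.ne'
  simp [traceEntropy, unifEntropy, div_self h2]

theorem traceEntropy_univ [Fintype X] {F : Finset (Finset X)} (hF : F.Nonempty) :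
    traceEntropy F Finset.univ = Real.log F.card := by
  have h2 : (F.card : ℝ) ≠ 0 := by exact_mod_cast hF.card_pos.ne'
  simp only [traceEntropy, unifEntropy, Finset.inter_univ]
  rw [Finset.sum_congr rfl (g := fun _ => Real.log F.card)]
  · rw [Finset.sum_const, nsmul_eq_mul]
    field_simp
  · intro x hx
    rw [Finset.filter_eq', if_pos hx]
    simp

theorem traceEntropy_singleton_le {F : Finset (Finset X)} (hF : F.Nonempty) (i : X) :
    traceEntropy F {i} ≤ Real.binEntropy (density F i) := by
  have h2 : (0 : ℝ) < F.card := by exact_mod_cast hF.card_pos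
  refine (unifEntropy_le hF _ (fun z => if i ∈ z then density F i else 1 - density F i)
    ?_ ?_).trans (le_of_eq ?_)
  · intro T hT
    by_cases hi : i ∈ T
    · simpa [hi] using density_pos hT hi
    · simpa [hi] using density_lt_one hT hi
  · refine (Finset.sum_le_sum_of_subset_of_nonneg (t := {∅, {i}}) ?_ ?_).trans ?_
    · intro z hz
      obtain ⟨T, -, rfl⟩ := Finset.mem_image.1 hz
      by_cases hi : i ∈ T <;> simp [hi]
    · intro z _ _
      have := density_nonneg F i
      have := density_le_one F i
      split_ifs <;> linarith
    · rw [Finset.sum_pair (by simp)]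
      simp
  · have e : ∀ T ∈ F, -Real.log (if i ∈ T ∩ {i} then density F i else 1 - density F i) =
        if i ∈ T then -Real.log (density F i) else -Real.log (1 - density F i) := by
      intro T _
      by_cases hi : i ∈ T <;> simp [hi]
    rw [Finset.sum_congr rfl e, sum_ite_mem_eq_density hF, mul_div_cancel_left₀ _ h2.ne',
      Real.binEntropy, Real.log_inv, Real.log_inv]

/-- Total mass of a product of Bernoulli laws; it normalises the reference weights used below in
Gibbs' inequality. -/
theorem sum_prod_ite_mem [Fintype X] (x : X → ℝ) :
    ∑ D : Finset X, ∏ i, (if i ∈ D then x i else 1 - x i) = 1 := by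
  have h := Finset.prod_add x (fun i => 1 - x i) (Finset.univ : Finset X)
  simp only [add_sub_cancel, Finset.prod_const_one, Finset.powerset_univ] at h
  refine (Finset.sum_congr rfl fun D _ => ?_).trans h.symm
  rw [Finset.prod_ite]
  congr 1
  · simp
  · refine Finset.prod_congr ?_ fun _ _ => rfl
    ext i
    simp

/-- If `S ∈ A` is determined by `S \ T`, then the entropy of the pair `(S \ T, T ∩ Y)` bounds the
size of `A`. -/
theorem log_card_add_traceEntropy_le [Fintype X] {A B : Finset (Finset X)} (hA : A.Nonempty)
    (hB : B.Nonempty)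
    (hAB : ∀ S ∈ A, ∀ S' ∈ A, ∀ T ∈ B, ∀ T' ∈ B, S \ T = S' \ T' → S = S') (Y : Finset X) :
    Real.log A.card + (∑ S ∈ A, traceEntropy B (S ∪ Y)) / A.card ≤
      traceEntropy B Y + ∑ i, if i ∈ Y then (1 - density B i) * Real.binEntropy (density A i)
        else Real.binEntropy (density A i * (1 - density B i)) := by
  have cA : (0 : ℝ) < A.card := by exact_mod_cast hA.card_pos
  have cB : (0 : ℝ) < B.card := by exact_mod_cast hB.card_pos
  set p := density A with hp
  set q := density B with hq
  set f : Finset X × Finset X → Finset X × Finset X := fun z => (z.1 \ z.2, z.2 ∩ Y) with hf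
  -- The probability of `i ∈ S \ T` given `T ∩ Y = v` when `i ∈ Y`, and the unconditional one
  -- otherwise. The reference law draws `T ∩ Y` from its true distribution `P`, then the coordinates
  -- of `S \ T` independently.
  set x : Finset X → X → ℝ := fun v i =>
    if i ∈ Y then (if i ∈ v then 0 else p i) else p i * (1 - q i) with hx
  have hx0 : ∀ v i, 0 ≤ x v i := by
    intro v i
    have := density_nonneg A i
    have := density_le_one B i
    simp only [hx]
    split_ifs
    · exact le_rfl
    · assumption
    · exact mul_nonneg (by assumption) (by linarith)
  have hx1 : ∀ v i, x v i ≤ 1 := by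
    intro v i
    have := density_nonneg A i
    have := density_le_one A i
    have := density_nonneg B i
    simp only [hx]
    split_ifs
    · exact zero_le_one
    · assumption
    · nlinarith
  set w : Finset X → Finset X → X → ℝ := fun D v i => if i ∈ D then x v i else 1 - x v i with hw
  have hw0 : ∀ D v i, 0 ≤ w D v i := by
    intro D v i
    simp only [hw]
    split_ifs
    · exact hx0 v i
    · linarith [hx1 v i]
  set P : Finset X → ℝ := fun v => (B.filter fun T => T ∩ Y = v).card / B.card with hP
  have hP0 : ∀ T ∈ B, 0 < P (T ∩ Y) := fun T hT =>
    div_pos (card_fiber_pos (fun T => T ∩ Y) hT) cB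
  have hwpos : ∀ S ∈ A, ∀ T ∈ B, ∀ i, 0 < w (S \ T) (T ∩ Y) i := by
    intro S hS T hT i
    have a0 := density_nonneg A i
    have a1 := density_le_one A i
    have b0 := density_nonneg B i
    have b1 := density_le_one B i
    by_cases hY : i ∈ Y <;> by_cases hiT : i ∈ T <;> by_cases hiS : i ∈ S <;>
      simp only [hw, hx, hY, hiT, hiS, Finset.mem_sdiff, Finset.mem_inter, and_true, and_false,
        not_true_eq_false, not_false_eq_true, if_true, if_false]
    · norm_num
    · norm_num
    · exact density_pos hS hiS
    · linarith [density_lt_one hS hiS]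
    · nlinarith [density_pos hT hiT]
    · nlinarith [density_pos hT hiT]
    · exact mul_pos (density_pos hS hiS) (by linarith [density_lt_one hT hiT])
    · nlinarith [density_lt_one hS hiS]
  have hG := unifEntropy_le (hA.product hB) f (fun z => P z.2 * ∏ i, w z.1 z.2 i)
    (by
      rintro ⟨S, T⟩ hST
      obtain ⟨hS, hT⟩ := Finset.mem_product.1 hST
      exact mul_pos (hP0 T hT) (Finset.prod_pos fun i _ => hwpos S hS T hT i))
    (by
      refine (Finset.sum_le_sum_of_subset_of_nonneg
        (t := (Finset.univ : Finset (Finset X)) ×ˢ B.image fun T => T ∩ Y) ?_ ?_).trans ?_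
      · intro z hz
        obtain ⟨⟨S, T⟩, hST, rfl⟩ := Finset.mem_image.1 hz
        exact Finset.mem_product.2 ⟨Finset.mem_univ _,
          Finset.mem_image_of_mem _ (Finset.mem_product.1 hST).2⟩
      · intro z _ _
        exact mul_nonneg (by simp only [hP]; positivity) (Finset.prod_nonneg fun i _ => hw0 _ _ i)
      · rw [Finset.sum_product_right]
        simp only [← Finset.mul_sum, hw, sum_prod_ite_mem, mul_one]
        have h1 := Finset.card_eq_sum_card_image (fun T => T ∩ Y) B
        simp only [hP]
        rw [← Finset.sum_div, div_le_one cB, h1]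
        push_cast
        exact le_rfl)
  -- Once `S \ T` reveals `S`, it also reveals `T ∩ S`; a fibre of `f` is thus a fibre of the trace
  -- on `S ∪ Y`.
  have hfib : ∀ S ∈ A, ∀ T ∈ B, ((A ×ˢ B).filter fun z => f z = f (S, T)).card =
      (B.filter fun T' => T' ∩ (S ∪ Y) = T ∩ (S ∪ Y)).card := by
    intro S hS T hT
    refine Finset.card_bij' (fun z _ => z.2) (fun T' _ => (S, T')) ?_ ?_ ?_ ?_
    · rintro ⟨S', T'⟩ h
      simp only [Finset.mem_filter, Finset.mem_product, hf, Prod.mk.injEq] at h ⊢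
      obtain ⟨⟨hS', hT'⟩, h1, h2⟩ := h
      obtain rfl := hAB _ hS' _ hS _ hT' _ hT h1
      refine ⟨hT', ?_⟩
      ext i
      have e1 := Finset.ext_iff.1 h1 i
      have e2 := Finset.ext_iff.1 h2 i
      simp only [Finset.mem_sdiff, Finset.mem_inter, Finset.mem_union] at e1 e2 ⊢
      tauto
    · intro T' h
      simp only [Finset.mem_filter, Finset.mem_product, hf, Prod.mk.injEq] at h ⊢
      refine ⟨⟨hS, h.1⟩, ?_, ?_⟩ <;>
      · ext i
        have e1 := Finset.ext_iff.1 h.2 i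
        simp only [Finset.mem_sdiff, Finset.mem_inter, Finset.mem_union] at e1 ⊢
        tauto
    · rintro ⟨S', T'⟩ h
      simp only [Finset.mem_filter, Finset.mem_product, hf, Prod.mk.injEq] at h ⊢
      exact ⟨hAB _ hS _ h.1.1 _ hT _ h.1.2 h.2.1.symm, trivial⟩
    · intro T' h
      rfl
  have hL : unifEntropy (A ×ˢ B) f =
      Real.log A.card + (∑ S ∈ A, traceEntropy B (S ∪ Y)) / A.card := by
    simp only [unifEntropy, traceEntropy]
    rw [Finset.sum_product, Finset.card_product]
    have e : ∀ S ∈ A, ∑ T ∈ B, Real.log (((A.card * B.card : ℕ) : ℝ) /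
        ((A ×ˢ B).filter fun z => f z = f (S, T)).card) =
        B.card * Real.log A.card + ∑ T ∈ B, Real.log (B.card /
          (B.filter fun T' => T' ∩ (S ∪ Y) = T ∩ (S ∪ Y)).card) := by
      intro S hS
      rw [← nsmul_eq_mul, ← Finset.sum_const, ← Finset.sum_add_distrib]
      refine Finset.sum_congr rfl fun T hT => ?_
      have h3 := card_fiber_pos (fun T' => T' ∩ (S ∪ Y)) hT
      rw [hfib S hS T hT, ← Real.log_mul cA.ne' (div_pos cB h3).ne']
      push_cast
      rw [mul_div_assoc]
    rw [Finset.sum_congr rfl e, Finset.sum_add_distrib, Finset.sum_const, nsmul_eq_mul,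
      ← Finset.sum_div]
    push_cast
    field_simp
  have hR : (∑ z ∈ A ×ˢ B, -Real.log (P (f z).2 * ∏ i, w (f z).1 (f z).2 i)) / (A ×ˢ B).card =
      traceEntropy B Y + ∑ i, if i ∈ Y then (1 - q i) * Real.binEntropy (p i)
        else Real.binEntropy (p i * (1 - q i)) := by
    have e : ∀ z ∈ A ×ˢ B, -Real.log (P (f z).2 * ∏ i, w (f z).1 (f z).2 i) =
        Real.log (B.card / (B.filter fun T' => T' ∩ Y = z.2 ∩ Y).card) +
          ∑ i, -Real.log (w (z.1 \ z.2) (z.2 ∩ Y) i) := by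
      rintro ⟨S, T⟩ hST
      obtain ⟨hS, hT⟩ := Finset.mem_product.1 hST
      have h3 := card_fiber_pos (fun T' => T' ∩ Y) hT
      simp only [hf]
      rw [Real.log_mul (hP0 T hT).ne' (Finset.prod_pos fun i _ => hwpos S hS T hT i).ne',
        Real.log_prod (fun i _ => (hwpos S hS T hT i).ne'), Finset.sum_neg_distrib, neg_add]
      congr 1
      rw [← Real.log_inv]
      simp only [hP, inv_div]
    have e2 : ∀ i, ∑ z ∈ A ×ˢ B, -Real.log (w (z.1 \ z.2) (z.2 ∩ Y) i) =
        A.card * B.card * (if i ∈ Y then (1 - q i) * Real.binEntropy (p i)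
        else Real.binEntropy (p i * (1 - q i))) := by
      intro i
      rw [Finset.sum_product_right]
      by_cases hY : i ∈ Y
      · have e3 : ∀ T ∈ B, ∑ S ∈ A, -Real.log (w (S \ T) (T ∩ Y) i) =
            if i ∈ T then 0 else A.card * Real.binEntropy (p i) := by
          intro T _
          by_cases hiT : i ∈ T
          · simp [hw, hx, hY, hiT]
          · have e4 : ∀ S ∈ A, -Real.log (w (S \ T) (T ∩ Y) i) =
                if i ∈ S then -Real.log (p i) else -Real.log (1 - p i) := by
              intro S _
              by_cases hiS : i ∈ S <;> simp [hw, hx, hY, hiT, hiS]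
            rw [if_neg hiT, Finset.sum_congr rfl e4, sum_ite_mem_eq_density hA, Real.binEntropy,
              Real.log_inv, Real.log_inv]
        rw [Finset.sum_congr rfl e3, sum_ite_mem_eq_density hB, if_pos hY]
        ring
      · have e3 : ∀ T ∈ B, ∑ S ∈ A, -Real.log (w (S \ T) (T ∩ Y) i) =
            if i ∈ T then -(A.card * Real.log (1 - p i * (1 - q i))) else
              A.card * (p i * -Real.log (p i * (1 - q i)) +
                (1 - p i) * -Real.log (1 - p i * (1 - q i))) := by
          intro T _
          by_cases hiT : i ∈ T
          · simp [hw, hx, hY, hiT]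
          · have e4 : ∀ S ∈ A, -Real.log (w (S \ T) (T ∩ Y) i) =
                if i ∈ S then -Real.log (p i * (1 - q i)) else
                  -Real.log (1 - p i * (1 - q i)) := by
              intro S _
              by_cases hiS : i ∈ S <;> simp [hw, hx, hY, hiT, hiS]
            rw [if_neg hiT, Finset.sum_congr rfl e4, sum_ite_mem_eq_density hA]
        rw [Finset.sum_congr rfl e3, sum_ite_mem_eq_density hB, if_neg hY, Real.binEntropy,
              Real.log_inv, Real.log_inv]
        ring
    rw [Finset.sum_congr rfl e, Finset.sum_add_distrib, Finset.sum_comm,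
      Finset.sum_congr rfl fun i _ => e2 i, ← Finset.mul_sum, Finset.sum_product,
      Finset.card_product]
    simp only [Finset.sum_const, nsmul_eq_mul]
    simp only [traceEntropy, unifEntropy]
    push_cast
    field_simp
  rw [hL, hR] at hG
  exact hG

end TraceEntropy

/-! ### From trace entropies to a sum over coordinates. -/

/-- The greedy algorithm for polymatroids: a submodular function dominates an additive function
that agrees with it on all superlevel sets of `l`. -/
theorem exists_additive_le_of_submodular {X : Type*} [DecidableEq X] (E : Finset X → ℝ)
    (h0 : E ∅ = 0) (hE : ∀ S T, E (S ∪ T) + E (S ∩ T) ≤ E S + E T) (l : X → ℝ) (s : Finset X) :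
    ∃ b : X → ℝ, (∀ S ⊆ s, ∑ i ∈ S, b i ≤ E S) ∧ ∑ i ∈ s, b i = E s ∧
      ∀ t, ∑ i ∈ s.filter (fun i => t < l i), b i = E (s.filter fun i => t < l i) := by
  -- Elements enter in decreasing order of `l`, each receiving its marginal increment of `E`;
  -- superlevel sets are then initial segments of the order.
  induction s using Finset.induction_on_max_value (fun i => -l i) with
  | empty =>
    refine ⟨0, ?_, by simp [h0], fun t => by simp [h0]⟩
    intro S hS
    rw [Finset.subset_empty.1 hS]
    simp [h0]
  | insert a s ha hmax ih =>
    obtain ⟨b, hb1, hb2, hb3⟩ := ih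
    set b' : X → ℝ := Function.update b a (E (insert a s) - E s) with hb'
    have hbb : ∀ S : Finset X, a ∉ S → ∑ i ∈ S, b' i = ∑ i ∈ S, b i := by
      intro S hS
      refine Finset.sum_congr rfl fun i hi => ?_
      rw [hb', Function.update_of_ne]
      rintro rfl
      exact hS hi
    have hba : b' a = E (insert a s) - E s := by simp [hb']
    have htot : ∑ i ∈ insert a s, b' i = E (insert a s) := by
      rw [Finset.sum_insert ha, hbb s ha, hb2, hba]
      ring
    refine ⟨b', ?_, htot, ?_⟩
    · intro S hS
      by_cases haS : a ∈ S
      · have hsub : S.erase a ⊆ s := by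
          intro i hi
          rcases Finset.mem_insert.1 (hS (Finset.mem_of_mem_erase hi)) with h | h
          · exact absurd h (Finset.ne_of_mem_erase hi)
          · exact h
        have h1 := hE S s
        have e1 : S ∪ s = insert a s := by
          ext i
          simp only [Finset.mem_union, Finset.mem_insert]
          constructor
          · rintro (h | h)
            · exact Finset.mem_insert.1 (hS h)
            · exact Or.inr h
          · rintro (rfl | h)
            · exact Or.inl haS
            · exact Or.inr h
        have e2 : S ∩ s = S.erase a := by
          ext i
          simp only [Finset.mem_inter, Finset.mem_erase]
          constructor
          · rintro ⟨h, h'⟩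
            exact ⟨fun e => ha (e ▸ h'), h⟩
          · rintro ⟨h, h'⟩
            exact ⟨h', hsub (Finset.mem_erase.2 ⟨h, h'⟩)⟩
        rw [e1, e2] at h1
        rw [← Finset.add_sum_erase S b' haS, hbb _ (Finset.notMem_erase a S), hba]
        linarith [hb1 _ hsub]
      · rw [hbb S haS]
        refine hb1 S fun i hi => ?_
        rcases Finset.mem_insert.1 (hS hi) with h | h
        · exact absurd (h ▸ hi) haS
        · exact h
    · intro t
      by_cases hat : t < l a
      · have : (insert a s).filter (fun i => t < l i) = insert a s := by
          refine Finset.filter_true_of_mem fun i hi => ?_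
          rcases Finset.mem_insert.1 hi with rfl | h
          · exact hat
          · linarith [hmax i h]
        rw [this, htot]
      · rw [Finset.filter_insert, if_neg hat, hbb _ (by simp [ha]), hb3]

/-- Averaging a family of inequalities over the superlevel sets of `l`. -/
theorem le_sum_mul_of_forall_superlevel {X : Type*} [Fintype X] (l x : X → ℝ)
    (hl0 : ∀ i, 0 ≤ l i) (hl1 : ∀ i, l i ≤ 1) (K : ℝ)
    (h : ∀ t, K ≤ ∑ i, if t < l i then x i else 0) : K ≤ ∑ i, l i * x i := by
  have hint : ∀ i, IntervalIntegrable (fun t => if t < l i then x i else 0)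
      MeasureTheory.volume 0 1 := by
    intro i
    rw [intervalIntegrable_iff_integrableOn_Ioc_of_le zero_le_one]
    have : (fun t => if t < l i then x i else 0) = (Set.Iio (l i)).indicator fun _ => x i := by
      ext t
      simp [Set.indicator]
    rw [this]
    exact (MeasureTheory.integrableOn_const (by simp)).indicator measurableSet_Iio
  -- A uniform threshold in `[0, 1]` puts `i` in the superlevel set with probability `l i`; no sign
  -- of `x i` is needed.
  have hval : ∀ i, ∫ t in (0 : ℝ)..1, (if t < l i then x i else 0) = l i * x i := by
    intro i
    have : (fun t => if t < l i then x i else 0) = (Set.Iio (l i)).indicator fun _ => x i := by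
      ext t
      simp [Set.indicator]
    rw [this, intervalIntegral.integral_of_le zero_le_one,
      MeasureTheory.integral_Ioc_eq_integral_Ioo,
      MeasureTheory.setIntegral_indicator measurableSet_Iio]
    have e : Set.Ioo (0 : ℝ) 1 ∩ Set.Iio (l i) = Set.Ioo 0 (l i) := by
      ext t
      simp only [Set.mem_inter_iff, Set.mem_Ioo, Set.mem_Iio]
      exact ⟨fun h => ⟨h.1.1, h.2⟩, fun h => ⟨⟨h.1, h.2.trans_le (hl1 i)⟩, h.2⟩⟩
    rw [e, MeasureTheory.setIntegral_const]
    simp [hl0 i]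
  calc K = ∫ _ in (0 : ℝ)..1, K := by simp
    _ ≤ ∫ t in (0 : ℝ)..1, ∑ i, (if t < l i then x i else 0) := by
        apply intervalIntegral.integral_mono zero_le_one
        · exact intervalIntegrable_const
        · have := IntervalIntegrable.sum Finset.univ fun i _ => hint i
          simpa only [Finset.sum_fn] using this
        · exact fun t => h t
    _ = ∑ i, l i * x i := by
        rw [intervalIntegral.integral_finsetSum fun i _ => hint i]
        exact Finset.sum_congr rfl fun i _ => hval i

/-- The contribution of a coordinate with densities `p` and `q` to the bound on the entropy of a
recovering pair. -/
noncomputable def coordBound (κ p q : ℝ) : ℝ :=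
  if p ≤ κ then Real.binEntropy (p * (1 - q)) + (κ - p) * Real.binEntropy q
  else κ / p * Real.binEntropy (p * (1 - q)) + (1 - κ / p) * ((1 - q) * Real.binEntropy p)

theorem log_card_add_mul_log_card_le {X : Type*} [DecidableEq X] [Fintype X]
    {A B : Finset (Finset X)} (hA : A.Nonempty) (hB : B.Nonempty)
    (hAB : ∀ S ∈ A, ∀ S' ∈ A, ∀ T ∈ B, ∀ T' ∈ B, S \ T = S' \ T' → S = S') {κ : ℝ} (hκ : 0 < κ) :
    Real.log A.card + κ * Real.log B.card ≤
      ∑ i, coordBound κ (density A i) (density B i) := by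
  have cA : (0 : ℝ) < A.card := by exact_mod_cast hA.card_pos
  set p := density A with hp
  set q := density B with hq
  -- After averaging, `b i` has coefficient `κ - p i * (1 - l i)`. This `l i` makes it vanish if `p
  -- i > κ`, and otherwise leaves `κ - p i ≥ 0`, so that `b i ≤ binEntropy (q i)` applies.
  set l : X → ℝ := fun i => if p i ≤ κ then 0 else 1 - κ / p i with hl
  have hl0 : ∀ i, 0 ≤ l i := by
    intro i
    simp only [hl]
    split_ifs with h
    · exact le_rfl
    · push Not at h
      have : κ / p i ≤ 1 := (div_le_one (hκ.trans h)).2 h.le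
      linarith
  have hl1 : ∀ i, l i ≤ 1 := by
    intro i
    simp only [hl]
    split_ifs with h
    · exact zero_le_one
    · push Not at h
      have : 0 < κ / p i := div_pos hκ (hκ.trans h)
      linarith
  obtain ⟨b, hb1, hb2, hb3⟩ := exists_additive_le_of_submodular (traceEntropy B)
    (traceEntropy_empty B) (traceEntropy_submodular B) l Finset.univ
  rw [traceEntropy_univ hB] at hb2
  have hbi : ∀ i, b i ≤ Real.binEntropy (q i) := fun i => by
    have := hb1 {i} (Finset.subset_univ _)
    rw [Finset.sum_singleton] at this
    exact this.trans (traceEntropy_singleton_le hB i)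
  have hmain := le_sum_mul_of_forall_superlevel l
    (fun i => (1 - q i) * Real.binEntropy (p i) - Real.binEntropy (p i * (1 - q i)) + p i * b i)
    hl0 hl1 (Real.log A.card - ∑ i, (Real.binEntropy (p i * (1 - q i)) - p i * b i)) (by
      intro t
      set Y := Finset.univ.filter fun i => t < l i with hY
      have h1 := log_card_add_traceEntropy_le hA hB hAB Y
      -- The minorant is evaluated on `S ∪ Y`; it is exact on `Y`, and each `i ∉ Y` lies in `S` with
      -- probability `p i`.
      have h2 : traceEntropy B Y + ∑ i, (if t < l i then 0 else p i * b i) ≤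
          (∑ S ∈ A, traceEntropy B (S ∪ Y)) / A.card := by
        rw [le_div_iff₀ cA, ← hb3 t]
        have h3 : ∀ S ∈ A, ∑ i, (if t < l i then b i else if i ∈ S then b i else 0) ≤
            traceEntropy B (S ∪ Y) := by
          intro S _
          refine le_trans (le_of_eq ?_) (hb1 (S ∪ Y) (Finset.subset_univ _))
          rw [← Finset.sum_filter_add_sum_filter_not Finset.univ (fun i => i ∈ S ∪ Y)]
          rw [Finset.sum_eq_zero (s := Finset.univ.filter fun i => ¬ i ∈ S ∪ Y), add_zero]
          · have e : Finset.univ.filter (fun i => i ∈ S ∪ Y) = S ∪ Y := by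
              ext i
              simp
            rw [e]
            refine Finset.sum_congr rfl fun i hi => ?_
            by_cases h : t < l i
            · rw [if_pos h]
            · have : i ∈ S := by simpa [hY, h] using hi
              rw [if_neg h, if_pos this]
          · intro i hi
            have : i ∉ S ∧ ¬ t < l i := by simpa [hY] using hi
            rw [if_neg this.2, if_neg this.1]
        refine le_trans (le_of_eq ?_) (Finset.sum_le_sum h3)
        rw [Finset.sum_comm, Finset.sum_filter, ← Finset.sum_add_distrib, Finset.sum_mul]
        refine Finset.sum_congr rfl fun i _ => ?_
        by_cases h : t < l i
        · simp [h, mul_comm]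
        · simp only [h, if_false]
          rw [sum_ite_mem_eq_density hA]
          ring
      have h4 : ∑ i, (if i ∈ Y then (1 - q i) * Real.binEntropy (p i)
          else Real.binEntropy (p i * (1 - q i))) - ∑ i, (if t < l i then 0 else p i * b i) -
          ∑ i, (Real.binEntropy (p i * (1 - q i)) - p i * b i) =
          ∑ i, (if t < l i then (1 - q i) * Real.binEntropy (p i) -
            Real.binEntropy (p i * (1 - q i)) + p i * b i else 0) := by
        rw [← Finset.sum_sub_distrib, ← Finset.sum_sub_distrib]
        refine Finset.sum_congr rfl fun i _ => ?_
        by_cases h : t < l i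
        · simp only [hY, Finset.mem_filter, Finset.mem_univ, h, true_and, if_true]
          ring
        · simp only [hY, Finset.mem_filter, Finset.mem_univ, h, true_and, if_false]
          ring
      linarith)
  have hfin : ∑ i, (Real.binEntropy (p i * (1 - q i)) - p i * b i) +
      ∑ i, l i * ((1 - q i) * Real.binEntropy (p i) - Real.binEntropy (p i * (1 - q i)) +
        p i * b i) + κ * ∑ i, b i ≤ ∑ i, coordBound κ (p i) (q i) := by
    rw [Finset.mul_sum, ← Finset.sum_add_distrib, ← Finset.sum_add_distrib]
    refine Finset.sum_le_sum fun i _ => ?_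
    simp only [coordBound, hl]
    split_ifs with h
    · nlinarith [mul_le_mul_of_nonneg_left (hbi i) (sub_nonneg.2 h)]
    · push Not at h
      have hpi : p i ≠ 0 := (hκ.trans h).ne'
      apply le_of_eq
      field_simp
      ring
  rw [hb2] at hfin
  linarith

/-! ### Certified numerical bound for one coordinate. -/

/-- Gibbs' inequality for the binary entropy. -/
theorem binEntropy_le_of_log {u x a b : ℝ} (hu0 : 0 < u) (hu1 : u < 1) (hx0 : 0 ≤ x) (hx1 : x ≤ 1)
    (ha : -Real.log u ≤ a) (hb : -Real.log (1 - u) ≤ b) :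
    Real.binEntropy x ≤ x * a + (1 - x) * b := by
  have key : ∀ y v : ℝ, 0 ≤ y → 0 < v → y * Real.log y⁻¹ ≤ y * -Real.log v + (v - y) := by
    intro y v hy hv
    rcases hy.eq_or_lt with rfl | hy
    · simp [hv.le]
    · have h := Real.log_le_sub_one_of_pos (div_pos hv hy)
      rw [Real.log_div hv.ne' hy.ne'] at h
      have h2 := mul_le_mul_of_nonneg_left h hy.le
      have h3 : y * (v / y - 1) = v - y := by field_simp
      rw [h3] at h2
      rw [Real.log_inv]
      linarith
  have h1 := key x u hx0 hu0
  have h2 := key (1 - x) (1 - u) (by linarith) (by linarith)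
  have h3 := mul_le_mul_of_nonneg_left ha hx0
  have h4 := mul_le_mul_of_nonneg_left hb (sub_nonneg.2 hx1)
  unfold Real.binEntropy
  linarith

/-- Upper bounds for `-log (k / 20)`, in units of `10⁻⁴`, for `1 ≤ k ≤ 19`. -/
def negLogTable : List ℕ :=
  [29958, 23026, 18972, 16095, 13863, 12040, 10499, 9163, 7986, 6932,
    5979, 5109, 4308, 3567, 2877, 2232, 1626, 1054, 513]

/-- A rational upper bound for `-log (k / 20)`. -/
def negLogUpper (k : ℕ) : ℚ := (negLogTable.getD (k - 1) 0 : ℕ) / 10000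

/-- The numerator of a fraction with denominator `20` in `(0, 1)` close to `u`. -/
def tangentNode (u : ℚ) : ℕ := max 1 (min 19 (20 * u + 1 / 2).floor.toNat)

/-- Taylor sums bound `exp` from below at nonnegative arguments, so this rational check proves that
`exp` of each table entry is at least `20 / k`. -/
theorem one_le_mul_taylor_negLogUpper : ∀ k ∈ List.range' 1 19, 0 ≤ negLogUpper k ∧
    1 ≤ (k / 20 : ℚ) * ∑ j ∈ Finset.range 18, negLogUpper k ^ j / (j.factorial : ℚ) := by
  decide +kernel

theorem neg_log_le_negLogUpper {k : ℕ} (h1 : 1 ≤ k) (h2 : k ≤ 19) :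
    -Real.log (k / 20) ≤ negLogUpper k := by
  obtain ⟨h3, h4⟩ := one_le_mul_taylor_negLogUpper k (by simp only [List.mem_range'_1]; omega)
  have h3' : (0 : ℝ) ≤ negLogUpper k := by exact_mod_cast h3
  have h4' : (1 : ℝ) ≤ (k / 20 : ℝ) *
      ∑ j ∈ Finset.range 18, (negLogUpper k : ℝ) ^ j / (j.factorial : ℝ) := by
    have h : ((1 : ℚ) : ℝ) ≤ ((k / 20 * ∑ j ∈ Finset.range 18,
        negLogUpper k ^ j / (j.factorial : ℚ) : ℚ) : ℝ) := Rat.cast_le.2 h4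
    push_cast at h
    exact h
  have hk : (0 : ℝ) < k / 20 := by positivity
  have h5 := Real.sum_le_exp_of_nonneg h3' 18
  have h6 : 1 ≤ (k / 20 : ℝ) * Real.exp (negLogUpper k) :=
    h4'.trans (mul_le_mul_of_nonneg_left h5 hk.le)
  have h7 := Real.log_nonneg h6
  rw [Real.log_mul hk.ne' (Real.exp_pos _).ne', Real.log_exp] at h7
  linarith

/-- The line of slope `negLogUpper k - negLogUpper (20 - k)` above the graph of the entropy. -/
theorem binEntropy_le_tangent (u : ℚ) {x : ℝ} (hx0 : 0 ≤ x) (hx1 : x ≤ 1) :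
    Real.binEntropy x ≤ x * negLogUpper (tangentNode u) +
      (1 - x) * negLogUpper (20 - tangentNode u) := by
  -- The clamping in `tangentNode` keeps both `k` and `20 - k` within the table.
  have h1 : 1 ≤ tangentNode u := le_max_left _ _
  have h2 : tangentNode u ≤ 19 := max_le (by norm_num) (min_le_left _ _)
  generalize tangentNode u = k at h1 h2 ⊢
  have h1' : (1 : ℝ) ≤ k := by exact_mod_cast h1
  have h2' : (k : ℝ) ≤ 19 := by exact_mod_cast h2
  refine binEntropy_le_of_log (u := (k / 20 : ℝ)) (by positivity) (by linarith) hx0 hx1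
    (neg_log_le_negLogUpper h1 h2) ?_
  have h3 := neg_log_le_negLogUpper (k := 20 - k) (by omega) (by omega)
  rw [Nat.cast_sub (by omega)] at h3
  convert h3 using 3
  push_cast
  ring

section BoxBounds

variable {R : Type*} [Field R]

/-- Bilinear upper bound for `coordBound κ p q` when `p ≤ κ`. -/
def lowBound (κ α β a b p q : R) : R :=
  p * (1 - q) * α + (1 - p * (1 - q)) * β + (κ - p) * (q * a + (1 - q) * b)

/-- Bilinear upper bound for `coordBound κ p q` when `κ ≤ p₁ ≤ p ≤ p₂`. -/
def highBound (κ p₁ p₂ m α β a b p q : R) : R :=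
  κ * (1 - q) * (α - β) + κ * β * ((p₁ + p₂ - p) / (p₁ * p₂)) +
    (1 - q) * ((p - κ) * (a - b) + (1 - κ * (2 / m - p / m ^ 2)) * b)

end BoxBounds

theorem coordBound_le_lowBound {κ α β a b p q : ℝ}
    (h1 : ∀ x : ℝ, 0 ≤ x → x ≤ 1 → Real.binEntropy x ≤ x * α + (1 - x) * β)
    (h2 : ∀ x : ℝ, 0 ≤ x → x ≤ 1 → Real.binEntropy x ≤ x * a + (1 - x) * b)
    (hp0 : 0 ≤ p) (hp1 : p ≤ 1) (hq0 : 0 ≤ q) (hq1 : q ≤ 1) (hpκ : p ≤ κ) :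
    coordBound κ p q ≤ lowBound κ α β a b p q := by
  rw [coordBound, if_pos hpκ, lowBound]
  have := h1 (p * (1 - q)) (mul_nonneg hp0 (by linarith)) (by nlinarith)
  have := mul_le_mul_of_nonneg_left (h2 q hq0 hq1) (sub_nonneg.2 hpκ)
  linarith

/-- Entropy tangents leave terms in `1 / p`, which are not affine. Where `1 / p` has a nonnegative
coefficient it is replaced by its chord on `[p₁, p₂]`, and where the coefficient is nonpositive by
its tangent at `m`. -/
theorem coordBound_le_highBound {κ p₁ p₂ m α β a b p q : ℝ} (hκ : 0 < κ)
    (h1 : ∀ x : ℝ, 0 ≤ x → x ≤ 1 → Real.binEntropy x ≤ x * α + (1 - x) * β)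
    (h2 : ∀ x : ℝ, 0 ≤ x → x ≤ 1 → Real.binEntropy x ≤ x * a + (1 - x) * b)
    (hp1 : p ≤ 1) (hq0 : 0 ≤ q) (hq1 : q ≤ 1) (hκp : κ ≤ p₁) (hp₁ : p₁ ≤ p) (hp₂ : p ≤ p₂)
    (hm : 0 < m) :
    coordBound κ p q ≤ highBound κ p₁ p₂ m α β a b p q := by
  have hp : 0 < p := by linarith
  have hp₁0 : 0 < p₁ := by linarith
  have hp₂0 : 0 < p₂ := by linarith
  -- The two branches of `coordBound` agree at `p = κ`, so boxes may share that boundary.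
  have e : coordBound κ p q = κ / p * Real.binEntropy (p * (1 - q)) +
      (1 - κ / p) * ((1 - q) * Real.binEntropy p) := by
    unfold coordBound
    split_ifs with h
    · have : p = κ := by linarith
      subst this
      rw [div_self hp.ne']
      ring
    · rfl
  have hβ : 0 ≤ β := by simpa using h1 0 le_rfl zero_le_one
  have hb : 0 ≤ b := by simpa using h2 0 le_rfl zero_le_one
  have i1 := mul_le_mul_of_nonneg_left
    (h1 (p * (1 - q)) (mul_nonneg hp.le (by linarith)) (by nlinarith)) (div_pos hκ hp).le
  have hκ1 : κ / p ≤ 1 := (div_le_one hp).2 (by linarith)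
  have i2 := mul_le_mul_of_nonneg_left (mul_le_mul_of_nonneg_left (h2 p hp.le hp1)
    (sub_nonneg.2 hq1)) (sub_nonneg.2 hκ1)
  have i3 : 1 / p ≤ (p₁ + p₂ - p) / (p₁ * p₂) := by
    rw [div_le_div_iff₀ hp (mul_pos hp₁0 hp₂0)]
    nlinarith [mul_nonneg (sub_nonneg.2 hp₁) (sub_nonneg.2 hp₂)]
  have i4 : 2 / m - p / m ^ 2 ≤ 1 / p := by
    rw [div_sub_div _ _ hm.ne' (by positivity), div_le_div_iff₀ (by positivity) hp]
    nlinarith [mul_nonneg hm.le (sq_nonneg (p - m))]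
  have i5 := mul_le_mul_of_nonneg_left i3 (mul_nonneg hκ.le hβ)
  have i6 := mul_le_mul_of_nonneg_left i4
    (mul_nonneg (mul_nonneg hκ.le hb) (sub_nonneg.2 hq1))
  have e1 : κ / p * (p * (1 - q) * α + (1 - p * (1 - q)) * β) =
      κ * (1 - q) * (α - β) + κ * β * (1 / p) := by
    field_simp
    ring
  have e2 : (1 - κ / p) * ((1 - q) * (p * a + (1 - p) * b)) =
      (1 - q) * ((p - κ) * (a - b) + b) - κ * b * (1 - q) * (1 / p) := by
    field_simp
    ring
  rw [e1] at i1
  rw [e2] at i2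
  rw [e, highBound]
  linarith

theorem bilinear_le_of_corners {c₀ c₁ c₂ c₃ p₁ p₂ q₁ q₂ p q M : ℝ} (hp₁ : p₁ ≤ p) (hp₂ : p ≤ p₂)
    (hq₁ : q₁ ≤ q) (hq₂ : q ≤ q₂) (h₁₁ : c₀ + c₁ * p₁ + c₂ * q₁ + c₃ * (p₁ * q₁) ≤ M)
    (h₁₂ : c₀ + c₁ * p₁ + c₂ * q₂ + c₃ * (p₁ * q₂) ≤ M)
    (h₂₁ : c₀ + c₁ * p₂ + c₂ * q₁ + c₃ * (p₂ * q₁) ≤ M)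
    (h₂₂ : c₀ + c₁ * p₂ + c₂ * q₂ + c₃ * (p₂ * q₂) ≤ M) :
    c₀ + c₁ * p + c₂ * q + c₃ * (p * q) ≤ M := by
  have affine : ∀ {x y x₁ x₂ : ℝ}, x₁ ≤ x → x ≤ x₂ → ∀ {c d : ℝ}, c + d * x₁ ≤ y →
      c + d * x₂ ≤ y → c + d * x ≤ y := by
    intro x y x₁ x₂ h1 h2 c d h3 h4
    rcases le_total 0 d with hd | hd
    · nlinarith
    · nlinarith
  have a1 : c₀ + c₂ * q₁ + (c₁ + c₃ * q₁) * p ≤ M :=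
    affine hp₁ hp₂ (by linarith) (by linarith)
  have a2 : c₀ + c₂ * q₂ + (c₁ + c₃ * q₂) * p ≤ M :=
    affine hp₁ hp₂ (by linarith) (by linarith)
  have a3 : c₀ + c₁ * p + (c₂ + c₃ * p) * q ≤ M :=
    affine hq₁ hq₂ (by linarith) (by linarith)
  linarith

/-- A function that is affine in each of two real variables. -/
def IsBilinear (g : ℝ → ℝ → ℝ) : Prop :=
  ∃ c₀ c₁ c₂ c₃ : ℝ, ∀ p q, g p q = c₀ + c₁ * p + c₂ * q + c₃ * (p * q)

theorem isBilinear_lowBound (κ α β a b : ℝ) : IsBilinear (lowBound κ α β a b) :=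
  ⟨β + κ * b, α - β - b, κ * (a - b), -(α - β) - (a - b), fun p q => by unfold lowBound; ring⟩

theorem isBilinear_highBound (κ p₁ p₂ m α β a b : ℝ) :
    IsBilinear (highBound κ p₁ p₂ m α β a b) :=
  ⟨κ * (α - β) + κ * β * (p₁ + p₂) / (p₁ * p₂) - κ * (a - b) + (1 - 2 * κ / m) * b,
    -(κ * β / (p₁ * p₂)) + (a - b + κ * b / m ^ 2),
    -(κ * (α - β) - κ * (a - b) + (1 - 2 * κ / m) * b), -(a - b + κ * b / m ^ 2),
    fun p q => by unfold highBound; ring⟩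

theorem IsBilinear.add_swap {f g : ℝ → ℝ → ℝ} (hf : IsBilinear f) (hg : IsBilinear g) :
    IsBilinear fun p q => f p q + g q p := by
  obtain ⟨c₀, c₁, c₂, c₃, hf⟩ := hf
  obtain ⟨d₀, d₁, d₂, d₃, hg⟩ := hg
  exact ⟨c₀ + d₀, c₁ + d₂, c₂ + d₁, c₃ + d₃, fun p q => by simp only [hf, hg]; ring⟩

/-- Bilinear upper bound for `coordBound (3 / 10) p q` on the box `[p₁, p₂] × [q₁, q₂]`, which
lies on one side of the line `p = 3 / 10`. -/
def boxBound (p₁ p₂ q₁ q₂ p q : ℚ) : ℚ :=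
  let pc := (p₁ + p₂) / 2
  let qc := (q₁ + q₂) / 2
  let k := tangentNode (pc * (1 - qc))
  if p₂ ≤ 3 / 10 then
    let l := tangentNode qc
    lowBound (3 / 10) (negLogUpper k) (negLogUpper (20 - k)) (negLogUpper l)
      (negLogUpper (20 - l)) p q
  else
    let l := tangentNode pc
    highBound (3 / 10) p₁ p₂ pc (negLogUpper k) (negLogUpper (20 - k)) (negLogUpper l)
      (negLogUpper (20 - l)) p q

/-- Passes from rational computation to real points: the majorant is bilinear over `ℝ` and agrees
with `boxBound` at rational points, so four rational corner tests control the whole box. -/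
theorem exists_isBilinear_boxBound {p₁ p₂ q₁ q₂ : ℚ} (hp : p₂ ≤ 3 / 10 ∨ 3 / 10 ≤ p₁) :
    ∃ g : ℝ → ℝ → ℝ, IsBilinear g ∧ (∀ p q : ℚ, g p q = boxBound p₁ p₂ q₁ q₂ p q) ∧
      ∀ p q : ℝ, 0 ≤ p → p ≤ 1 → 0 ≤ q → q ≤ 1 → p₁ ≤ p → p ≤ p₂ →
        coordBound (3 / 10) p q ≤ g p q := by
  by_cases h : p₂ ≤ 3 / 10
  · refine ⟨_, isBilinear_lowBound (3 / 10)
      (negLogUpper (tangentNode ((p₁ + p₂) / 2 * (1 - (q₁ + q₂) / 2))))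
      (negLogUpper (20 - tangentNode ((p₁ + p₂) / 2 * (1 - (q₁ + q₂) / 2))))
      (negLogUpper (tangentNode ((q₁ + q₂) / 2))) (negLogUpper (20 - tangentNode ((q₁ + q₂) / 2))),
      ?_, ?_⟩
    · intro p q
      simp only [boxBound, if_pos h, lowBound]
      push_cast
      ring
    · intro p q hp0 hp1 hq0 hq1 _ hp₂
      refine coordBound_le_lowBound (fun x => binEntropy_le_tangent _)
        (fun x => binEntropy_le_tangent _) hp0 hp1 hq0 hq1 (hp₂.trans ?_)
      have h' : (p₂ : ℝ) ≤ ((3 / 10 : ℚ) : ℝ) := by exact_mod_cast h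
      push_cast at h'
      exact h'
  · have hp' := hp.resolve_left h
    have hpR : (3 / 10 : ℝ) ≤ p₁ := by
      have h' : ((3 / 10 : ℚ) : ℝ) ≤ p₁ := by exact_mod_cast hp'
      push_cast at h'
      exact h'
    refine ⟨_, isBilinear_highBound (3 / 10) p₁ p₂ (((p₁ + p₂) / 2 : ℚ) : ℝ)
      (negLogUpper (tangentNode ((p₁ + p₂) / 2 * (1 - (q₁ + q₂) / 2))))
      (negLogUpper (20 - tangentNode ((p₁ + p₂) / 2 * (1 - (q₁ + q₂) / 2))))
      (negLogUpper (tangentNode ((p₁ + p₂) / 2))) (negLogUpper (20 - tangentNode ((p₁ + p₂) / 2))),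
      ?_, ?_⟩
    · intro p q
      simp only [boxBound, if_neg h, highBound]
      push_cast
      ring
    · intro p q hp0 hp1 hq0 hq1 hp₁ hp₂
      refine coordBound_le_highBound (by norm_num) (fun x => binEntropy_le_tangent _)
        (fun x => binEntropy_le_tangent _) hp1 hq0 hq1 hpR hp₁ hp₂ ?_
      push_cast
      linarith

/-- Test whether the bilinear bounds certify `coordBound (3 / 10) p q + coordBound (3 / 10) q p ≤ M`
on the box `[p₁, p₂] × [q₁, q₂]`. -/
def BoxCertified (M p₁ p₂ q₁ q₂ : ℚ) : Prop :=
  ((p₂ ≤ 3 / 10 ∨ 3 / 10 ≤ p₁) ∧ (q₂ ≤ 3 / 10 ∨ 3 / 10 ≤ q₁)) ∧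
    (boxBound p₁ p₂ q₁ q₂ p₁ q₁ + boxBound q₁ q₂ p₁ p₂ q₁ p₁ ≤ M ∧
      boxBound p₁ p₂ q₁ q₂ p₁ q₂ + boxBound q₁ q₂ p₁ p₂ q₂ p₁ ≤ M) ∧
    (boxBound p₁ p₂ q₁ q₂ p₂ q₁ + boxBound q₁ q₂ p₁ p₂ q₁ p₂ ≤ M ∧
      boxBound p₁ p₂ q₁ q₂ p₂ q₂ + boxBound q₁ q₂ p₁ p₂ q₂ p₂ ≤ M)

instance (M p₁ p₂ q₁ q₂ : ℚ) : Decidable (BoxCertified M p₁ p₂ q₁ q₂) := by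
  unfold BoxCertified; infer_instance

theorem coordBound_add_le_of_boxCertified {M p₁ p₂ q₁ q₂ : ℚ} (h : BoxCertified M p₁ p₂ q₁ q₂)
    {p q : ℝ} (hp0 : 0 ≤ p) (hp1 : p ≤ 1) (hq0 : 0 ≤ q)
    (hq1 : q ≤ 1) (hp₁ : p₁ ≤ p) (hp₂ : p ≤ p₂) (hq₁ : q₁ ≤ q) (hq₂ : q ≤ q₂) :
    coordBound (3 / 10) p q + coordBound (3 / 10) q p ≤ M := by
  obtain ⟨⟨hp, hq⟩, ⟨h₁₁, h₁₂⟩, h₂₁, h₂₂⟩ := h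
  obtain ⟨f, hf, hfQ, hf'⟩ := exists_isBilinear_boxBound (q₁ := q₁) (q₂ := q₂) hp
  obtain ⟨g, hg, hgQ, hg'⟩ := exists_isBilinear_boxBound (q₁ := p₁) (q₂ := p₂) hq
  obtain ⟨c₀, c₁, c₂, c₃, hc⟩ := hf.add_swap hg
  have corner : ∀ {x y : ℚ}, boxBound p₁ p₂ q₁ q₂ x y + boxBound q₁ q₂ p₁ p₂ y x ≤ M →
      c₀ + c₁ * (x : ℝ) + c₂ * y + c₃ * (x * y) ≤ M := by
    intro x y h
    rw [← hc x y]
    simp only [hfQ, hgQ]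
    exact_mod_cast h
  refine (add_le_add (hf' p q hp0 hp1 hq0 hq1 hp₁ hp₂) (hg' q p hq0 hq1 hp0 hp1 hq₁ hq₂)).trans ?_
  refine (hc p q).trans_le ?_
  exact bilinear_le_of_corners hp₁ hp₂ hq₁ hq₂ (corner h₁₁) (corner h₁₂) (corner h₂₁) (corner h₂₂)

/-- Bisection procedure certifying `coordBound (3 / 10) p q + coordBound (3 / 10) q p ≤ M` on the
box `[p₁, p₂] × [q₁, q₂]`. -/
def certify (M : ℚ) : ℕ → ℚ → ℚ → ℚ → ℚ → Bool
  | 0, p₁, p₂, q₁, q₂ => decide (BoxCertified M p₁ p₂ q₁ q₂)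
  | n + 1, p₁, p₂, q₁, q₂ =>
    decide (BoxCertified M p₁ p₂ q₁ q₂) ||
      if q₂ - q₁ ≤ p₂ - p₁ then
        certify M n p₁ ((p₁ + p₂) / 2) q₁ q₂ && certify M n ((p₁ + p₂) / 2) p₂ q₁ q₂
      else
        certify M n p₁ p₂ q₁ ((q₁ + q₂) / 2) && certify M n p₁ p₂ ((q₁ + q₂) / 2) q₂

theorem coordBound_add_le_of_certify {M : ℚ} (n : ℕ) {p₁ p₂ q₁ q₂ : ℚ}
    (h : certify M n p₁ p₂ q₁ q₂ = true) {p q : ℝ} (hp0 : 0 ≤ p) (hp1 : p ≤ 1) (hq0 : 0 ≤ q)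
    (hq1 : q ≤ 1) (hp₁ : p₁ ≤ p) (hp₂ : p ≤ p₂) (hq₁ : q₁ ≤ q) (hq₂ : q ≤ q₂) :
    coordBound (3 / 10) p q + coordBound (3 / 10) q p ≤ M := by
  induction n generalizing p₁ p₂ q₁ q₂ with
  | zero =>
    exact coordBound_add_le_of_boxCertified (of_decide_eq_true h) hp0 hp1 hq0 hq1 hp₁ hp₂ hq₁ hq₂
  | succ n ih =>
    rw [certify, Bool.or_eq_true] at h
    rcases h with h | h
    · exact coordBound_add_le_of_boxCertified (of_decide_eq_true h) hp0 hp1 hq0 hq1 hp₁ hp₂ hq₁ hq₂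
    · split_ifs at h
      · rw [Bool.and_eq_true] at h
        rcases le_total p (((p₁ + p₂) / 2 : ℚ) : ℝ) with h' | h'
        · exact ih h.1 hp₁ h' hq₁ hq₂
        · exact ih h.2 h' hp₂ hq₁ hq₂
      · rw [Bool.and_eq_true] at h
        rcases le_total q (((q₁ + q₂) / 2 : ℚ) : ℝ) with h' | h'
        · exact ih h.1 hp₁ hp₂ hq₁ h'
        · exact ih h.2 hp₁ hp₂ h' hq₂

theorem coordBound_add_coordBound_le {p q : ℝ} (hp0 : 0 ≤ p) (hp1 : p ≤ 1) (hq0 : 0 ≤ q)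
    (hq1 : q ≤ 1) :
    coordBound (3 / 10) p q + coordBound (3 / 10) q p ≤ ((13 / 10 * (8108 / 10000) : ℚ) : ℝ) := by
  -- The square is cut at `3 / 10`, where `coordBound` changes form; the fourth region follows from
  -- `c2` by symmetry. In the target, `13 / 10` is `1 + κ` and `8108 / 10000` lies just below `log
  -- 2.2499`.
  have c1 : certify (13 / 10 * (8108 / 10000)) 10 0 (3 / 10) 0 (3 / 10) = true := by decide +kernel
  have c2 : certify (13 / 10 * (8108 / 10000)) 10 0 (3 / 10) (3 / 10) 1 = true := by decide +kernel
  have c3 : certify (13 / 10 * (8108 / 10000)) 10 (3 / 10) 1 (3 / 10) 1 = true := by decide +kernel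
  rcases le_total p (3 / 10) with h | h <;> rcases le_total q (3 / 10) with h' | h'
  · exact coordBound_add_le_of_certify 10 c1 hp0 hp1 hq0 hq1 (by simpa) (by simpa) (by simpa)
      (by simpa)
  · exact coordBound_add_le_of_certify 10 c2 hp0 hp1 hq0 hq1 (by simpa) (by simpa) (by simpa)
      (by simpa)
  · rw [add_comm]
    exact coordBound_add_le_of_certify 10 c2 hq0 hq1 hp0 hp1 (by simpa) (by simpa) (by simpa)
      (by simpa)
  · exact coordBound_add_le_of_certify 10 c3 hp0 hp1 hq0 hq1 (by simpa) (by simpa) (by simpa)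
      (by simpa)

theorem rational_le_log : (8108 / 10000 : ℝ) ≤ Real.log 2.2499 := by
  rw [Real.le_log_iff_exp_le (by norm_num)]
  refine (Real.exp_bound' (by norm_num) (by norm_num) (n := 8) (by norm_num)).trans ?_
  norm_num [Finset.sum_range_succ, Nat.factorial]

/-! ### The upper bound for recovering pairs. -/

theorem IsRecoveringPair.card_mul_card_le {X : Type*} [Fintype X] [DecidableEq X]
    {A B : Finset (Finset X)} (h : IsRecoveringPair A B) :
    (A.card : ℝ) * B.card ≤ 2.2499 ^ Fintype.card X := by
  rcases A.eq_empty_or_nonempty with rfl | hA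
  · simp only [Finset.card_empty, Nat.cast_zero, zero_mul]
    positivity
  rcases B.eq_empty_or_nonempty with rfl | hB
  · simp only [Finset.card_empty, Nat.cast_zero, mul_zero]
    positivity
  have cA : (0 : ℝ) < A.card := by exact_mod_cast hA.card_pos
  have cB : (0 : ℝ) < B.card := by exact_mod_cast hB.card_pos
  have h1 := log_card_add_mul_log_card_le hA hB
    (fun S hS S' hS' T hT T' hT' => (h S hS S' hS' T hT T' hT').1) (κ := 3 / 10) (by norm_num)
  have h2 := log_card_add_mul_log_card_le hB hA
    (fun T hT T' hT' S hS S' hS' => (h S hS S' hS' T hT T' hT').2) (κ := 3 / 10) (by norm_num)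
  have h3 : ∑ i, coordBound (3 / 10) (density A i) (density B i) +
      ∑ i, coordBound (3 / 10) (density B i) (density A i) ≤
      Fintype.card X * (13 / 10 * Real.log 2.2499) := by
    rw [← Finset.sum_add_distrib, ← nsmul_eq_mul, ← Finset.card_univ]
    refine Finset.sum_le_card_nsmul _ _ _ fun i _ => ?_
    refine (coordBound_add_coordBound_le (density_nonneg A i) (density_le_one A i)
      (density_nonneg B i) (density_le_one B i)).trans ?_
    push_cast
    linarith [rational_le_log]
  rw [← Real.log_le_log_iff (mul_pos cA cB) (by positivity), Real.log_mul cA.ne' cB.ne',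
    Real.log_pow]
  linarith

/-! ### Block products and existence of the limits. -/

/-- The union of two sets placed on consecutive blocks of the ground set. -/
def blockUnion {m n : ℕ} (z : Finset (Fin m) × Finset (Fin n)) : Finset (Fin (m + n)) :=
  (z.1.disjSum z.2).map finSumFinEquiv.toEmbedding

theorem blockUnion_injective {m n : ℕ} : Function.Injective (blockUnion (m := m) (n := n)) := by
  rintro ⟨S, T⟩ ⟨S', T'⟩ h
  have h1 := Finset.map_injective _ h
  simpa [Finset.disjSum_inj] using h1

theorem blockUnion_sdiff {m n : ℕ} (z w : Finset (Fin m) × Finset (Fin n)) :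
    blockUnion z \ blockUnion w = blockUnion (z.1 \ w.1, z.2 \ w.2) := by
  unfold blockUnion
  rw [← Finset.map_sdiff]
  congr 1
  ext (i | i) <;> simp

/-- All block unions of members of two families. -/
def blockProd {m n : ℕ} (A : Finset (Finset (Fin m))) (A' : Finset (Finset (Fin n))) :
    Finset (Finset (Fin (m + n))) :=
  (A ×ˢ A').map ⟨blockUnion, blockUnion_injective⟩

theorem card_blockProd {m n : ℕ} (A : Finset (Finset (Fin m))) (A' : Finset (Finset (Fin n))) :
    (blockProd A A').card = A.card * A'.card := by
  rw [blockProd, Finset.card_map, Finset.card_product]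

theorem mem_blockProd {m n : ℕ} {A : Finset (Finset (Fin m))} {A' : Finset (Finset (Fin n))}
    {S : Finset (Fin (m + n))} :
    S ∈ blockProd A A' ↔ ∃ z : Finset (Fin m) × Finset (Fin n),
      (z.1 ∈ A ∧ z.2 ∈ A') ∧ blockUnion z = S := by
  simp only [blockProd, Finset.mem_map, Finset.mem_product, Function.Embedding.coeFn_mk]

theorem IsRecoveringPair.blockProd {m n : ℕ} {A B : Finset (Finset (Fin m))}
    {A' B' : Finset (Finset (Fin n))} (h : IsRecoveringPair A B) (h' : IsRecoveringPair A' B') :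
    IsRecoveringPair (blockProd A A') (blockProd B B') := by
  intro S₁ hS₁ S₂ hS₂ T₁ hT₁ T₂ hT₂
  obtain ⟨a, ha, rfl⟩ := mem_blockProd.1 hS₁
  obtain ⟨b, hb, rfl⟩ := mem_blockProd.1 hS₂
  obtain ⟨c, hc, rfl⟩ := mem_blockProd.1 hT₁
  obtain ⟨d, hd, rfl⟩ := mem_blockProd.1 hT₂
  have h1 := h _ ha.1 _ hb.1 _ hc.1 _ hd.1
  have h2 := h' _ ha.2 _ hb.2 _ hc.2 _ hd.2
  simp only [blockUnion_sdiff, blockUnion_injective.eq_iff, Prod.mk.injEq]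
  exact ⟨fun e => Prod.ext (h1.1 e.1) (h2.1 e.2), fun e => Prod.ext (h1.2 e.1) (h2.2 e.2)⟩

theorem IsCancellativePair.blockProd {m n : ℕ} {A B : Finset (Finset (Fin m))}
    {A' B' : Finset (Finset (Fin n))} (h : IsCancellativePair A B)
    (h' : IsCancellativePair A' B') :
    IsCancellativePair (blockProd A A') (blockProd B B') := by
  intro S₁ hS₁ S₂ hS₂ T₁ hT₁ T₂ hT₂
  obtain ⟨a, ha, rfl⟩ := mem_blockProd.1 hS₁
  obtain ⟨b, hb, rfl⟩ := mem_blockProd.1 hS₂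
  obtain ⟨c, hc, rfl⟩ := mem_blockProd.1 hT₁
  obtain ⟨d, hd, rfl⟩ := mem_blockProd.1 hT₂
  have h1 := h _ ha.1 _ hb.1 _ hc.1 _ hd.1
  have h2 := h' _ ha.2 _ hb.2 _ hc.2 _ hd.2
  simp only [blockUnion_sdiff, blockUnion_injective.eq_iff, Prod.mk.injEq]
  exact ⟨fun e => Prod.ext (h1.1 e.1) (h2.1 e.2), fun e => Prod.ext (h1.2 e.1) (h2.2 e.2)⟩

theorem rpow_one_div_natCast_pow {x : ℝ} (hx : 0 ≤ x) {n : ℕ} (hn : n ≠ 0) :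
    (x ^ (1 / (n : ℝ))) ^ n = x := by
  rw [one_div, Real.rpow_inv_natCast_pow hx hn]

/-- Fekete's lemma for the optimal rate of a class of pairs of families that is closed under
block products. -/
theorem exists_tendsto_of_blockProd
    (Q : ∀ {n : ℕ}, Finset (Finset (Fin n)) → Finset (Finset (Fin n)) → Prop)
    (hQ1 : ∀ n, Q ({∅} : Finset (Finset (Fin n))) {∅})
    (hQ : ∀ {m n : ℕ} {A B : Finset (Finset (Fin m))} {A' B' : Finset (Finset (Fin n))},
      Q A B → Q A' B' → Q (blockProd A A') (blockProd B B'))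
    (g : ℕ → ℝ)
    (hg : ∀ n, IsGreatest {r | ∃ A B : Finset (Finset (Fin n)), Q A B ∧
      r = ((A.card : ℝ) * (B.card : ℝ)) ^ (1 / (n : ℝ))} (g n)) :
    ∃ L, Filter.Tendsto g Filter.atTop (nhds L) ∧ ∀ n ≠ 0, g n ≤ L := by
  have hg1 : ∀ n, 1 ≤ g n := fun n => (hg n).2 ⟨{∅}, {∅}, hQ1 n, by simp⟩
  have hg4 : ∀ n ≠ 0, g n ≤ 4 := by
    intro n hn
    obtain ⟨A, B, -, h⟩ := (hg n).1
    have hc : ∀ A : Finset (Finset (Fin n)), (A.card : ℝ) ≤ 2 ^ n := by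
      intro A
      have := Finset.card_le_univ A
      rw [Fintype.card_finset, Fintype.card_fin] at this
      exact_mod_cast this
    refine le_of_pow_le_pow_left₀ hn (by norm_num) ?_
    rw [h, rpow_one_div_natCast_pow (by positivity) hn]
    calc (A.card : ℝ) * B.card ≤ 2 ^ n * 2 ^ n :=
          mul_le_mul (hc A) (hc B) (by positivity) (by positivity)
      _ = 4 ^ n := by rw [← mul_pow]; norm_num
  have hmul : ∀ m n, g m ^ m * g n ^ n ≤ g (m + n) ^ (m + n) := by
    intro m n
    rcases eq_or_ne m 0 with rfl | hm
    · simp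
    rcases eq_or_ne n 0 with rfl | hn
    · simp
    obtain ⟨A, B, hAB, h⟩ := (hg m).1
    obtain ⟨A', B', hAB', h'⟩ := (hg n).1
    have h2 := (hg (m + n)).2 ⟨_, _, hQ hAB hAB', rfl⟩
    rw [h, h', rpow_one_div_natCast_pow (by positivity) hm,
      rpow_one_div_natCast_pow (by positivity) hn]
    refine le_trans (le_of_eq ?_) (pow_le_pow_left₀ (by positivity) h2 (m + n))
    rw [rpow_one_div_natCast_pow (by positivity) (by omega), card_blockProd, card_blockProd]
    push_cast
    ring
  -- Supermultiplicativity of `g n ^ n` becomes subadditivity after taking minus the logarithm.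
  have hsub : Subadditive fun n => -(n * Real.log (g n)) := by
    intro m n
    have pm : 0 < g m ^ m := pow_pos (zero_lt_one.trans_le (hg1 m)) m
    have pn : 0 < g n ^ n := pow_pos (zero_lt_one.trans_le (hg1 n)) n
    have := Real.log_le_log (mul_pos pm pn) (hmul m n)
    rw [Real.log_mul pm.ne' pn.ne', Real.log_pow, Real.log_pow, Real.log_pow] at this
    linarith
  have hdiv : ∀ n : ℕ, n ≠ 0 → -(n * Real.log (g n)) / n = -Real.log (g n) := by
    intro n hn
    have : (n : ℝ) ≠ 0 := by exact_mod_cast hn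
    field_simp
  have hbdd : BddBelow (Set.range fun n : ℕ => -(n * Real.log (g n)) / n) := by
    refine ⟨-Real.log 4, ?_⟩
    rintro _ ⟨n, rfl⟩
    rcases eq_or_ne n 0 with rfl | hn
    · have : 0 ≤ Real.log 4 := Real.log_nonneg (by norm_num)
      simpa using this
    · simp only [hdiv n hn]
      exact neg_le_neg (Real.log_le_log (zero_lt_one.trans_le (hg1 n)) (hg4 n hn))
  refine ⟨Real.exp (-hsub.lim), ?_, ?_⟩
  · have h1 := (Real.continuous_exp.tendsto _).comp (hsub.tendsto_lim hbdd).neg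
    refine h1.congr' ?_
    filter_upwards [Filter.eventually_ne_atTop 0] with n hn
    simp only [Function.comp_apply, hdiv n hn, neg_neg]
    exact Real.exp_log (zero_lt_one.trans_le (hg1 n))
  · intro n hn
    have h1 := hsub.lim_le_div hbdd hn
    simp only [hdiv n hn] at h1
    rw [← Real.log_le_iff_le_exp (zero_lt_one.trans_le (hg1 n))]
    linarith

theorem tendsto_maxRec : Filter.Tendsto maxRec Filter.atTop (nhds muRec) := by
  obtain ⟨L, hL, -⟩ := exists_tendsto_of_blockProd (fun A B => IsRecoveringPair A B)
    (fun n => by simp [IsRecoveringPair]) (fun h h' => h.blockProd h') maxRec isGreatest_maxRec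
  rwa [muRec, hL.limUnder_eq]

theorem tendsto_maxCan_and_le_muCan :
    Filter.Tendsto maxCan Filter.atTop (nhds muCan) ∧ ∀ n ≠ 0, maxCan n ≤ muCan := by
  obtain ⟨L, hL, h⟩ := exists_tendsto_of_blockProd (fun A B => IsCancellativePair A B)
    (fun n => by simp [IsCancellativePair]) (fun h h' => h.blockProd h') maxCan isGreatest_maxCan
  rw [muCan, hL.limUnder_eq]
  exact ⟨hL, h⟩

/-! ### Cancellative pairs from random linear codes. -/

/-- The functions whose values on a nonempty set sum to zero are a proportion `1 / |V|` of all. -/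
theorem card_filter_sum_eq_zero {ι V : Type*} [Fintype ι] [DecidableEq ι] [AddCommGroup V]
    [Fintype V] [DecidableEq V] {U : Finset ι} (hU : U.Nonempty) :
    (Finset.univ.filter fun H : ι → V => ∑ i ∈ U, H i = 0).card * Fintype.card V =
      Fintype.card (ι → V) := by
  obtain ⟨j, hj⟩ := hU
  -- Adding `v` at the single coordinate `j ∈ U` shifts the sum by `v`, so all fibres of the sum are
  -- equinumerous.
  have hs : ∀ v : V, ∑ i ∈ U, (Pi.single j v : ι → V) i = v := by
    intro v
    simp [Pi.single_apply, hj]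
  have h1 : ∀ v : V, (Finset.univ.filter fun H : ι → V => ∑ i ∈ U, H i = v).card =
      (Finset.univ.filter fun H : ι → V => ∑ i ∈ U, H i = 0).card := by
    intro v
    refine Finset.card_bij' (fun H _ => H - Pi.single j v) (fun H _ => H + Pi.single j v)
      ?_ ?_ ?_ ?_
    · intro H hH
      simp only [Finset.mem_filter, Finset.mem_univ, true_and] at hH ⊢
      simp only [Pi.sub_apply, Finset.sum_sub_distrib, hs, hH, sub_self]
    · intro H hH
      simp only [Finset.mem_filter, Finset.mem_univ, true_and] at hH ⊢
      simp only [Pi.add_apply, Finset.sum_add_distrib, hs, hH, zero_add]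
    · intro H _
      simp
    · intro H _
      simp
  have h2 := Finset.card_eq_sum_card_fiberwise (s := (Finset.univ : Finset (ι → V)))
    (t := (Finset.univ : Finset V)) (f := fun H => ∑ i ∈ U, H i) (by simp)
  rw [Finset.sum_congr rfl fun v _ => h1 v, Finset.sum_const, smul_eq_mul, Finset.card_univ,
    Finset.card_univ] at h2
  rw [h2, mul_comm]

/-- Sets whose columns in a matrix over `𝔽₂` are linearly independent and have a fixed sum form a
cancellative family. -/
theorem isCancellativePair_of_independent {ι V : Type*} [DecidableEq ι] [AddCommGroup V]
    (hV : ∀ v : V, v + v = 0) (H : ι → V) (s : V) {F : Finset (Finset ι)}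
    (hind : ∀ S ∈ F, ∀ U ⊆ S, ∑ i ∈ U, H i = 0 → U = ∅) (hsum : ∀ S ∈ F, ∑ i ∈ S, H i = s) :
    IsCancellativePair F F := by
  have key : ∀ S ∈ F, ∀ S' ∈ F, ∀ T ∈ F, S \ T = S' \ T → S = S' := by
    intro S hS S' hS' T hT h
    have h1 : ∑ i ∈ S \ S', H i + ∑ i ∈ S' \ S, H i = 0 := by
      have e1 := Finset.sum_inter_add_sum_sdiff S S' H
      have e2 := Finset.sum_inter_add_sum_sdiff S' S H
      rw [Finset.inter_comm S' S] at e2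
      rw [hsum S hS] at e1
      rw [hsum S' hS'] at e2
      rw [add_left_cancel (e1.trans e2.symm)]
      exact hV _
    have hd : Disjoint (S \ S') (S' \ S) :=
      Finset.disjoint_left.2 fun i hi hi' =>
        (Finset.mem_sdiff.1 hi').2 (Finset.mem_sdiff.1 hi).1
    rw [← Finset.sum_union hd] at h1
    -- If `S \ T = S' \ T`, the symmetric difference of `S` and `S'` lies in `T`; its columns sum to
    -- zero, so independence on `T` makes it empty.
    have h2 := hind T hT (S \ S' ∪ S' \ S) (by
      intro i hi
      by_contra hiT
      have := Finset.ext_iff.1 h i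
      simp only [Finset.mem_sdiff, Finset.mem_union] at this hi
      tauto) h1
    ext i
    have := Finset.ext_iff.1 h2 i
    simp only [Finset.mem_sdiff, Finset.mem_union, Finset.notMem_empty, iff_false] at this
    tauto
  exact fun S hS S' hS' T hT T' hT' => ⟨key S hS S' hS' T hT, key T hT T' hT' S hS⟩

/-- With columns in `𝔽₂ ^ (k + 1)`, a union bound over the nonempty subsets of a `k`-set shows that
it is independent for at least half of all matrices. Averaging fixes a matrix at the cost of a
factor `2`; pigeonhole on the column sum costs `2 ^ (k + 1)`. -/
theorem exists_isCancellativePair (n k : ℕ) : ∃ F : Finset (Finset (Fin n)),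
    IsCancellativePair F F ∧ n.choose k ≤ F.card * 2 ^ (k + 2) := by
  classical
  let V := Fin (k + 1) → ZMod 2
  have hcV : Fintype.card V = 2 ^ (k + 1) := by simp [V, ZMod.card]
  have hV : ∀ v : V, v + v = 0 := fun v => by
    ext i
    exact CharTwo.add_self_eq_zero (v i)
  set N := Fintype.card (Fin n → V) with hN
  let good : (Fin n → V) → Finset (Fin n) → Prop := fun H S =>
    ∀ U ⊆ S, ∑ i ∈ U, H i = 0 → U = ∅
  have hgood : ∀ S ∈ Finset.powersetCard k (Finset.univ : Finset (Fin n)),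
      N ≤ 2 * (Finset.univ.filter fun H => good H S).card := by
    intro S hS
    have hSk := (Finset.mem_powersetCard.1 hS).2
    have hbad : (Finset.univ.filter fun H : Fin n → V => ¬ good H S) ⊆
        (S.powerset.erase ∅).biUnion fun U =>
          Finset.univ.filter fun H : Fin n → V => ∑ i ∈ U, H i = 0 := by
      intro H hH
      simp only [good, Finset.mem_filter, Finset.mem_univ, true_and, not_forall] at hH
      obtain ⟨U, hU, h0, hne⟩ := hH
      simp only [Finset.mem_biUnion, Finset.mem_erase, Finset.mem_powerset, Finset.mem_filter,
        Finset.mem_univ, true_and]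
      exact ⟨U, ⟨hne, hU⟩, h0⟩
    have h1 : (Finset.univ.filter fun H : Fin n → V => ¬ good H S).card * 2 ^ (k + 1) ≤
        2 ^ k * N := by
      refine (Nat.mul_le_mul_right _ ((Finset.card_le_card hbad).trans
        Finset.card_biUnion_le)).trans ?_
      rw [Finset.sum_mul, Finset.sum_congr rfl (g := fun _ => N)]
      · rw [Finset.sum_const, smul_eq_mul]
        refine Nat.mul_le_mul_right _ ((Finset.card_erase_le).trans ?_)
        rw [Finset.card_powerset, hSk]
      · intro U hU
        rw [← hcV]
        exact card_filter_sum_eq_zero (Finset.nonempty_iff_ne_empty.2 (Finset.mem_erase.1 hU).1)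
    have h2 := Finset.card_filter_add_card_filter_not (s := (Finset.univ : Finset (Fin n → V)))
      (fun H => good H S)
    rw [Finset.card_univ, ← hN] at h2
    have h3 : 2 * (Finset.univ.filter fun H : Fin n → V => ¬ good H S).card ≤ N := by
      refine Nat.le_of_mul_le_mul_left ?_ (pow_pos (zero_lt_two (α := ℕ)) k)
      calc _ = (Finset.univ.filter fun H : Fin n → V => ¬ good H S).card * 2 ^ (k + 1) := by ring
        _ ≤ _ := h1
    omega
  obtain ⟨H, -, hH⟩ : ∃ H ∈ (Finset.univ : Finset (Fin n → V)), n.choose k ≤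
      2 * ((Finset.powersetCard k (Finset.univ : Finset (Fin n))).filter fun S =>
        good H S).card := by
    refine Finset.exists_le_of_sum_le Finset.univ_nonempty ?_
    rw [Finset.sum_const, smul_eq_mul, Finset.card_univ, ← hN, ← Finset.mul_sum]
    have : ∑ H : Fin n → V, ((Finset.powersetCard k (Finset.univ : Finset (Fin n))).filter fun S =>
        good H S).card = ∑ S ∈ Finset.powersetCard k (Finset.univ : Finset (Fin n)),
          (Finset.univ.filter fun H => good H S).card := by
      simp only [Finset.card_filter]
      exact Finset.sum_comm
    rw [this, Finset.mul_sum]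
    refine le_trans (le_of_eq ?_) (Finset.sum_le_sum hgood)
    rw [Finset.sum_const, smul_eq_mul, Finset.card_powersetCard, Finset.card_univ,
      Fintype.card_fin, mul_comm]
  set G := (Finset.powersetCard k (Finset.univ : Finset (Fin n))).filter fun S => good H S with hG
  obtain ⟨s, -, hs⟩ : ∃ s ∈ (Finset.univ : Finset V), G.card ≤
      (G.filter fun S => ∑ i ∈ S, H i = s).card * 2 ^ (k + 1) := by
    refine Finset.exists_le_of_sum_le Finset.univ_nonempty ?_
    rw [Finset.sum_const, smul_eq_mul, Finset.card_univ, hcV, ← Finset.sum_mul,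
      ← Finset.card_eq_sum_card_fiberwise (by simp), mul_comm]
  refine ⟨G.filter fun S => ∑ i ∈ S, H i = s, isCancellativePair_of_independent hV H s ?_ ?_, ?_⟩
  · intro S hS
    exact (Finset.mem_filter.1 (Finset.mem_filter.1 hS).1).2
  · intro S hS
    exact (Finset.mem_filter.1 hS).2
  · calc n.choose k ≤ 2 * G.card := hH
      _ ≤ 2 * ((G.filter fun S => ∑ i ∈ S, H i = s).card * 2 ^ (k + 1)) :=
          Nat.mul_le_mul_left _ hs
      _ = _ := by ring

/-- The terms `n.choose k / 2 ^ k` add up to `(1 + 1/2) ^ n`, and the largest is at least their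
average. -/
theorem exists_pow_le_choose (n : ℕ) : ∃ k : ℕ,
    (3 / 2 : ℝ) ^ n ≤ (n + 1) * (n.choose k / 2 ^ k) := by
  have h := add_pow (1 / 2 : ℝ) 1 n
  obtain ⟨k, -, hk⟩ : ∃ k ∈ Finset.range (n + 1), (3 / 2 : ℝ) ^ n / (n + 1) ≤
      (1 / 2 : ℝ) ^ k * 1 ^ (n - k) * n.choose k := by
    refine Finset.exists_le_of_sum_le ⟨0, by simp⟩ ?_
    rw [← h, Finset.sum_const, Finset.card_range, nsmul_eq_mul]
    push_cast
    rw [mul_div_cancel₀ _ (by positivity)]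
    norm_num
  refine ⟨k, ?_⟩
  rw [div_le_iff₀ (by positivity)] at hk
  refine hk.trans (le_of_eq ?_)
  rw [one_pow, mul_one, div_pow, one_pow]
  ring

theorem lt_muCan : 2.2499 < muCan := by
  -- Squaring the size of the family gives `2.25 ^ n` up to the factor `16 * (n + 1) ^ 2`, which
  -- `(2.25 / 2.2499) ^ n` eventually exceeds. A single such `n` suffices, as `maxCan n ≤ muCan`.
  have hlim : Filter.Tendsto (fun n : ℕ => ((n : ℝ) + 1) ^ 2 / (2.25 / 2.2499) ^ n) Filter.atTop
      (nhds 0) := by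
    have h1 := tendsto_pow_const_div_const_pow_of_one_lt 2 (r := (2.25 / 2.2499 : ℝ)) (by norm_num)
    have h2 := tendsto_pow_const_div_const_pow_of_one_lt 1 (r := (2.25 / 2.2499 : ℝ)) (by norm_num)
    have h3 := tendsto_pow_const_div_const_pow_of_one_lt 0 (r := (2.25 / 2.2499 : ℝ)) (by norm_num)
    have h4 := (h1.add (h2.const_mul 2)).add h3
    simp only [mul_zero, add_zero] at h4
    refine h4.congr fun n => ?_
    ring
  obtain ⟨n, hn, hn0⟩ := ((hlim.eventually (gt_mem_nhds (show (0 : ℝ) < 1 / 16 by norm_num))).and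
    (Filter.eventually_ne_atTop 0)).exists
  obtain ⟨k, hk⟩ := exists_pow_le_choose n
  obtain ⟨F, hF, hFc⟩ := exists_isCancellativePair n k
  have hFc' : (n.choose k : ℝ) ≤ F.card * 2 ^ (k + 2) := by exact_mod_cast hFc
  have h1 : (3 / 2 : ℝ) ^ n ≤ 4 * (n + 1) * F.card := by
    refine hk.trans ?_
    have : (n.choose k : ℝ) / 2 ^ k ≤ 4 * F.card := by
      rw [div_le_iff₀ (by positivity)]
      refine hFc'.trans (le_of_eq ?_)
      ring
    calc ((n : ℝ) + 1) * (n.choose k / 2 ^ k) ≤ (n + 1) * (4 * F.card) :=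
          mul_le_mul_of_nonneg_left this (by positivity)
      _ = _ := by ring
  have h2 : (2.25 : ℝ) ^ n ≤ 16 * (n + 1) ^ 2 * (F.card * F.card) := by
    calc (2.25 : ℝ) ^ n = (3 / 2 : ℝ) ^ n * (3 / 2 : ℝ) ^ n := by rw [← mul_pow]; norm_num
      _ ≤ (4 * (n + 1) * F.card) * (4 * (n + 1) * F.card) :=
          mul_le_mul h1 h1 (by positivity) (by positivity)
      _ = _ := by ring
  have h3 : 16 * ((n : ℝ) + 1) ^ 2 * 2.2499 ^ n < 2.25 ^ n := by
    rw [div_pow, div_lt_iff₀ (by positivity), ← mul_div_assoc, lt_div_iff₀ (by positivity)] at hn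
    linarith
  have h4 : (2.2499 : ℝ) ^ n < F.card * F.card := by
    have h5 : (0 : ℝ) < 16 * (n + 1) ^ 2 := by positivity
    exact lt_of_mul_lt_mul_left (h3.trans_le h2) h5.le
  have h6 := (isGreatest_maxCan n).2 ⟨F, F, hF, rfl⟩
  refine lt_of_lt_of_le ?_ (h6.trans (tendsto_maxCan_and_le_muCan.2 n hn0))
  refine lt_of_pow_lt_pow_left₀ n (by positivity) ?_
  rwa [rpow_one_div_natCast_pow (by positivity) hn0]

/-! ### Conclusion. -/

theorem maxRec_le {n : ℕ} (hn : n ≠ 0) : maxRec n ≤ 2.2499 := by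
  obtain ⟨A, B, hAB, h⟩ := (isGreatest_maxRec n).1
  refine le_of_pow_le_pow_left₀ hn (by norm_num) ?_
  rw [h, rpow_one_div_natCast_pow (by positivity) hn]
  simpa using hAB.card_mul_card_le

theorem theorem1p3 :
    Filter.Tendsto maxRec Filter.atTop (nhds muRec) ∧
    Filter.Tendsto maxCan Filter.atTop (nhds muCan) ∧
    (∀ (n : ℕ) (X : Type*) [Fintype X] [DecidableEq X] (A B : Finset (Finset X)),
      Fintype.card X = n → IsRecoveringPair A B →
      (A.card : ℝ) * (B.card : ℝ) ≤
        (max (2.2499 : ℝ) ((2.222 : ℝ) ^ (0.27 : ℝ) * muCan ^ (1 - 0.27 : ℝ))) ^ n) ∧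
    muRec < muCan := by
  refine ⟨tendsto_maxRec, tendsto_maxCan_and_le_muCan.1, ?_, ?_⟩
  · rintro n X _ _ A B rfl hAB
    exact hAB.card_mul_card_le.trans (pow_le_pow_left₀ (by norm_num) (le_max_left _ _) _)
  · refine lt_of_le_of_lt (le_of_tendsto tendsto_maxRec ?_) lt_muCan
    filter_upwards [Filter.eventually_ne_atTop 0] with n hn
    exact maxRec_le hn
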